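/- Let $(X_m)_{m\ge 0}$ be a homogeneous, irreducible discrete-time Markov chain on a finite set $\mathcal X$ with transition matrix $P=(P_{xy})$ (and arbitrary initial law), and let $(A_m)_{m\ge 1}$ be a process in $\mathbb R^d$ defined on the same probability space. Let $q^{xy}$, $x,y\in\mathcal X$, be probability measures on $\mathbb R^d$ such that $A_1,\dots,A_n$ are conditionally independent with $A_m$ distributed according to $q^{X_{m-1}X_m}$: for all $n$ and all $x_0,\dots,x_n\in\mathcal X$ with $\mathbb P(X_0=x_0,\dots,X_n=x_n)>0$, $$\mathbb P\big(A_1\in da_1,\dots,A_n\in da_n \,\big|\, X_0=x_0,\dots,X_n=x_n\big)=\prod_{m=1}^n q^{x_{m-1}x_m}(da_m).$$ In particular $q^{xy}$ is the law of $A_1$ given $X_0=x$, $X_1=y$ whenever this event has positive probability. Define, with values in $(-\infty,\infty]$, $$\phi^{xy}(\lambda)=\log\int e^{\lambda\cdot a}\,q^{xy}(da),\qquad \phi^{xy*}(a)=\sup_{\lambda\in\mathbb R^d}\big[\lambda\cdot a-\phi^{xy}(\lambda)\big],$$ $$\phi^{xy}_{|\cdot|}(s)=\log\int e^{s|a|_1}\,q^{xy}(da),\qquad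 \phi^{xy*}_{|\cdot|}(r)=\sup_{s\in\mathbb R}\big[rs-\phi^{xy}_{|\cdot|}(s)\big],$$ and assume that $\liminf_{r\to\infty}\phi^{xy*}_{|\cdot|}(r)/r=\infty$ for all $x,y\in\mathcal X$ with $P_{xy}>0$. For $n\ge1$ let $$K^n=\frac1n\sum_{m=1}^n \mathbf 1_{(X_{m-1},X_m)}A_m\in(\mathbb R^d)^{\mathcal X\times\mathcal X},\qquad \Theta^n=\frac1n\sum_{m=1}^n \mathbf 1_{(X_{m-1},X_m)}\in\mathcal P(\mathcal X\times\mathcal X).$$ Then the sequence $(K^n,\Theta^n)_{n\ge1}$ satisfies the large-deviation principle in $(\mathbb R^d)^{\mathcal X\times\mathcal X}\times\mathcal P(\mathcal X\times\mathcal X)$ with speed $n$ and good rate functional $$I(k,\theta)=\sum_{x,y\in\mathcal X}\theta_{xy}\,\phi^{xy*}\Big(\frac{k^{xy}}{\theta_{xy}}\Big)+\sum_{x,y\in\mathcal X}s\big(\theta_{xy}\,\big|\,\theta^{(1)}_x P_{xy}\big)$$ if $\theta^{(1)}=\theta^{(2)}$ and $k^{xy}=0$ whenever $\theta_{xy}=0$,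 and $I(k,\theta)=\infty$ otherwise. Here $\theta^{(1)}_x=\sum_y\theta_{xy}$ and $\theta^{(2)}_y=\sum_x\theta_{xy}$ are the marginals, terms of the first sum with $\theta_{xy}=0$ and $k^{xy}=0$ are read as $0$, and $s(a\mid b)=a\log\frac ab-a+b$ for $a,b>0$, $s(0\mid b)=b$ for $b\ge0$, and $s(a\mid b)=\infty$ otherwise. -/

import Mathlib

open MeasureTheory ProbabilityTheory Filter Topology
open scoped ENNReal

namespace PairLDP

noncomputable section

/-! ### Log-moment generating functions and their Legendre transforms -/

/-- The log-moment generating function `φ(l) = log ∫ exp (l · a) q(da)` of a measure on `ℝ^d`,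
with value `⊤` if the integral diverges. -/
def logMGF {d : ℕ} (q : Measure (Fin d → ℝ)) (l : Fin d → ℝ) : EReal :=
  ENNReal.log (∫⁻ a, ENNReal.ofReal (Real.exp (l ⬝ᵥ a)) ∂q)

/-- The Legendre transform `φ*(a) = sup_l [l · a - φ(l)]` of the log-moment generating function. -/
def logMGFConj {d : ℕ} (q : Measure (Fin d → ℝ)) (a : Fin d → ℝ) : EReal :=
  ⨆ l : Fin d → ℝ, ((l ⬝ᵥ a : ℝ) : EReal) - logMGF q l

/-- The log-moment generating function `s ↦ log ∫ exp (s |a|₁) q(da)` of the `ℓ¹`-norm. -/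
def logMGFNorm {d : ℕ} (q : Measure (Fin d → ℝ)) (s : ℝ) : EReal :=
  ENNReal.log (∫⁻ a, ENNReal.ofReal (Real.exp (s * ∑ i, |a i|)) ∂q)

/-- The Legendre transform `r ↦ sup_s [r s - log ∫ exp (s |a|₁) q(da)]`. -/
def logMGFNormConj {d : ℕ} (q : Measure (Fin d → ℝ)) (r : ℝ) : EReal :=
  ⨆ s : ℝ, ((r * s : ℝ) : EReal) - logMGFNorm q s

/-! ### The Markov chain and the process attached to its transitions -/

section Processes

variable {Ω 𝒳 : Type*} [MeasurableSpace Ω] {d : ℕ}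

/-- The event `X_0 = x_0, …, X_n = x_n`. -/
def pathEvent (X : ℕ → Ω → 𝒳) (n : ℕ) (x : ℕ → 𝒳) : Set Ω :=
  {ω | ∀ m ≤ n, X m ω = x m}

/-- `X` is a homogeneous Markov chain with transition matrix `P` (and arbitrary initial law): every
row of `P` is a probability vector, and given `X_0 = x_0, …, X_n = x_n`, an event of positive
probability, the next state `X_{n+1}` equals `y` with probability `P x_n y`. -/
structure IsMarkovChain [Fintype 𝒳] [DecidableEq 𝒳] (μ : Measure Ω) (P : Matrix 𝒳 𝒳 ℝ)
    (X : ℕ → Ω → 𝒳) : Prop where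
  stochastic : P ∈ Matrix.rowStochastic ℝ 𝒳
  markov : ∀ (n : ℕ) (x : ℕ → 𝒳) (y : 𝒳), μ (pathEvent X n x) ≠ 0 →
    μ[{ω | X (n + 1) ω = y} | pathEvent X n x] = ENNReal.ofReal (P (x n) y)

/-- Given `X_0 = x_0, …, X_n = x_n`, an event of positive probability, the random vectors
`A_1, …, A_n` are independent and `A_m` has law `q x_{m-1} x_m`. The case `n = 1` says that
`q x y` is the law of `A_1` given `X_0 = x, X_1 = y`. -/
def CondIndepOnTransitions (μ : Measure Ω) (X : ℕ → Ω → 𝒳) (A : ℕ → Ω → Fin d → ℝ)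
    (q : 𝒳 → 𝒳 → Measure (Fin d → ℝ)) : Prop :=
  ∀ (n : ℕ) (x : ℕ → 𝒳), μ (pathEvent X n x) ≠ 0 →
    (cond μ (pathEvent X n x)).map (fun ω (m : Fin n) => A (m + 1) ω) =
      Measure.pi (fun m : Fin n => q (x m) (x (m + 1)))

end Processes

/-! ### The pair-empirical objects -/

section Empirical

variable {Ω 𝒳 : Type*} [DecidableEq 𝒳] {d : ℕ}

/-- `K^n = n⁻¹ ∑_{m=1}^n 1_{(X_{m-1}, X_m)} A_m`, as an element of `(ℝ^d)^{𝒳 × 𝒳}`. -/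
def empiricalK (X : ℕ → Ω → 𝒳) (A : ℕ → Ω → Fin d → ℝ) (n : ℕ+) (ω : Ω) :
    𝒳 × 𝒳 → Fin d → ℝ :=
  fun p => (n : ℝ)⁻¹ • ∑ m ∈ Finset.Icc 1 (n : ℕ),
    if (X (m - 1) ω, X m ω) = p then A m ω else 0

variable [Fintype 𝒳]

/-- The pair-empirical measure `Θ^n = n⁻¹ ∑_{m=1}^n 1_{(X_{m-1}, X_m)}`, as an element of the set
of probability measures (probability vectors) on `𝒳 × 𝒳`. -/
def empiricalTheta (X : ℕ → Ω → 𝒳) (n : ℕ+) (ω : Ω) : stdSimplex ℝ (𝒳 × 𝒳) :=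
  ⟨fun p => (n : ℝ)⁻¹ * ∑ m ∈ Finset.Icc 1 (n : ℕ),
      if (X (m - 1) ω, X m ω) = p then 1 else 0, by
    refine ⟨fun p => ?_, ?_⟩
    · have h : (0 : ℝ) ≤ ∑ m ∈ Finset.Icc 1 (n : ℕ),
          if (X (m - 1) ω, X m ω) = p then (1 : ℝ) else 0 :=
        Finset.sum_nonneg fun m _ => by split_ifs <;> norm_num
      positivity
    · rw [← Finset.mul_sum, Finset.sum_comm]
      simp⟩

end Empirical

/-! ### Large-deviation principles -/

/-- The random variables `Y^n`, `n = 1, 2, …`, with values in the topological space `E`, satisfy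
the large-deviation principle with speed `n` and good rate functional `I`: the functional is
`[0, ∞]`-valued, lower semicontinuous with compact sublevel sets, and for every Borel set `B`
`- inf_{int B} I ≤ liminf n⁻¹ log ℙ(Y^n ∈ B) ≤ limsup n⁻¹ log ℙ(Y^n ∈ B) ≤ - inf_{cl B} I`. -/
structure SatisfiesLDP {Ω E : Type*} [MeasurableSpace Ω] [TopologicalSpace E] [MeasurableSpace E]
    [BorelSpace E] (μ : Measure Ω) (Y : ℕ+ → Ω → E) (I : E → EReal) : Prop where
  nonneg : ∀ z, 0 ≤ I z
  lowerSemicontinuous : LowerSemicontinuous I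
  good : ∀ c : ℝ, IsCompact {z | I z ≤ (c : EReal)}
  lower_bound : ∀ B : Set E, MeasurableSet B →
    -(⨅ z ∈ interior B, I z) ≤
      liminf (fun n : ℕ+ => ENNReal.log (μ (Y n ⁻¹' B)) / ((n : ℝ) : EReal)) atTop
  upper_bound : ∀ B : Set E, MeasurableSet B →
    limsup (fun n : ℕ+ => ENNReal.log (μ (Y n ⁻¹' B)) / ((n : ℝ) : EReal)) atTop ≤
      -(⨅ z ∈ closure B, I z)

/-! ### The rate functional -/

open scoped Classical in
/-- `s(a | b) = a log (a / b) - a + b` for `a, b > 0`, `s(0 | b) = b` for `b ≥ 0`, and `∞` in all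
other cases. -/
def relEnt (a b : ℝ) : EReal :=
  if 0 < a ∧ 0 < b then ((a * Real.log (a / b) - a + b : ℝ) : EReal)
  else if a = 0 ∧ 0 ≤ b then (b : EReal)
  else ⊤

section Rate

variable {𝒳 : Type*} [Fintype 𝒳]

/-- The first marginal `(e¹ # θ)_x = ∑_y θ_{xy}`. -/
def marginalFst (θ : 𝒳 × 𝒳 → ℝ) (x : 𝒳) : ℝ := ∑ y, θ (x, y)

/-- The second marginal `(e² # θ)_y = ∑_x θ_{xy}`. -/
def marginalSnd (θ : 𝒳 × 𝒳 → ℝ) (y : 𝒳) : ℝ := ∑ x, θ (x, y)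

open scoped Classical in
/-- The rate functional
`I(k, θ) = ∑ θ_{xy} φ^{xy*}(k^{xy} / θ_{xy}) + ∑ s(θ_{xy} | (e¹ # θ)_x P_{xy})` if `k ≪ θ` and the
two marginals of `θ` agree, and `I(k, θ) = ∞` otherwise. The summand
`θ_{xy} φ^{xy*}(k^{xy} / θ_{xy})` is read as `0` if `θ_{xy} = 0` and `k^{xy} = 0`. -/
def rate {d : ℕ} (P : Matrix 𝒳 𝒳 ℝ) (q : 𝒳 → 𝒳 → Measure (Fin d → ℝ))
    (z : (𝒳 × 𝒳 → Fin d → ℝ) × stdSimplex ℝ (𝒳 × 𝒳)) : EReal :=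
  let k := z.1
  let θ : 𝒳 × 𝒳 → ℝ := z.2.1
  if (∀ p, θ p = 0 → k p = 0) ∧ marginalFst θ = marginalSnd θ then
    (∑ x, ∑ y, if θ (x, y) = 0 then (0 : EReal) else
        (θ (x, y) : EReal) * logMGFConj (q x y) ((θ (x, y))⁻¹ • k (x, y))) +
      ∑ x, ∑ y, relEnt (θ (x, y)) (marginalFst θ x * P x y)
  else ⊤

end Rate

end

end PairLDP

/-! The rate functional is a supremum of affine functionals `tilt q lam g u` of `(k, θ)`: `lam`
produces the Legendre transforms, `g` (with `exp g` a substochastic density relative to `P`) the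
relative entropy, and `u` is a Lagrange multiplier for equality of the marginals (`tilt_le_rate`,
`exists_lt_tilt_of_lt_rate`). Evaluated at the empirical pair, `exp (n * tilt)` is a product of
one-step factors times a telescoping boundary term, hence a supermartingale up to a bounded factor.
Chebyshev's inequality, a compact cover and exponential tightness then give the upper bound.

The lower bound uses exposed points. Suppose the tilted mass is at least `1` and some other
functional of the family strictly exceeds the tilting one at every point except `z'`. The same
Chebyshev argument makes the tilted mass away from `z'` exponentially small, so every neighbourhood
of `z'` carries at least half of it, which bounds its untilted probability from below
(`satisfiesLDP_of_exposed`).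

The exposed points are the pairs `(θ ∇φ(lam), θ)` with `θ` balanced and charging exactly the support
of `P` (`exists_tilt_lt_of_ne`). By `exists_exposed_near` they approximate every pair of finite
rate: mix with a positive circulation, which exists by irreducibility, then solve a penalised
minimisation for each transition. The growth hypothesis enters through `hasExpMoments_of_growth`:
all exponential moments are finite, so the log-moment generating functions are finite and
differentiable. -/

namespace PairLDP

/-! ### An abstract large-deviation criterion through exponential tilts. -/

section Abstract

variable {Ω E : Type*} [MeasurableSpace Ω] {μ : Measure Ω} [TopologicalSpace E]
  [MeasurableSpace E] [BorelSpace E]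

/-- Exponential Chebyshev bound on closed sets under an exponential tilt. -/
lemma exists_setLIntegral_exp_le (Y : ℕ+ → Ω → E) (hY : ∀ n, Measurable (Y n))
    (N : E → ℝ) (hNcont : Continuous N) (hNcpt : ∀ M, IsCompact {z | N z ≤ M})
    (L : Set (E → ℝ)) (hLcont : ∀ l ∈ L, Continuous l)
    (hL : ∀ l ∈ L, ∃ C : ℝ, ∀ n : ℕ+,
      ∫⁻ ω, ENNReal.ofReal (Real.exp (n * l (Y n ω))) ∂μ ≤ ENNReal.ofReal C)
    (hN : ∀ s : ℝ, ∃ C : ℝ, ∀ n : ℕ+,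
      ∫⁻ ω, ENNReal.ofReal (Real.exp (n * (s * N (Y n ω)))) ∂μ ≤
        ENNReal.ofReal (Real.exp (n * C)))
    (f : E → ℝ) (hf : Continuous f) (s : ℝ) (hfs : ∀ z, f z ≤ s + s * N z)
    (F : Set E) (hF : IsClosed F) (c : ℝ) (hc : ∀ z ∈ F, ∃ l ∈ L, c < l z - f z) :
    ∃ c' > c, ∃ C : ℝ, ∀ n : ℕ+,
      ∫⁻ ω in Y n ⁻¹' F, ENNReal.ofReal (Real.exp (n * f (Y n ω))) ∂μ ≤
        ENNReal.ofReal (C * Real.exp (-(n * c'))) := by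
  -- The bound as a property of sets, stable under subsets and finite unions, so that it can be
  -- proved locally and glued by compactness.
  set p : Set E → Prop := fun S => ∃ c' > c, ∃ C : ℝ, 0 ≤ C ∧ ∀ n : ℕ+,
      ∫⁻ ω in Y n ⁻¹' S, ENNReal.ofReal (Real.exp (n * f (Y n ω))) ∂μ ≤
        ENNReal.ofReal (C * Real.exp (-(n * c'))) with hp
  have hmono : ∀ S T, S ⊆ T → p T → p S := by
    rintro S T hST ⟨c', hc', C, hC, h⟩
    exact ⟨c', hc', C, hC, fun n =>
      (lintegral_mono_set (Set.preimage_mono hST)).trans (h n)⟩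
  have hunion : ∀ S T, p S → p T → p (S ∪ T) := by
    rintro S T ⟨c₁, hc₁, C₁, hC₁, h₁⟩ ⟨c₂, hc₂, C₂, hC₂, h₂⟩
    refine ⟨min c₁ c₂, lt_min hc₁ hc₂, C₁ + C₂, by positivity, fun n => ?_⟩
    rw [Set.preimage_union]
    refine (lintegral_union_le _ _ _).trans ((add_le_add (h₁ n) (h₂ n)).trans ?_)
    rw [← ENNReal.ofReal_add (by positivity) (by positivity)]
    apply ENNReal.ofReal_le_ofReal
    rw [add_mul]
    gcongr
    · exact min_le_left _ _
    · exact min_le_right _ _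
  -- On `M < N z` one has `f z ≤ s + s * N z ≤ (s - M) + (s + 1) * N z`. The moment of order `s + 1`
  -- therefore suffices, and `M` is taken large enough to leave the rate `c + 1`.
  obtain ⟨C, hC⟩ := hN (s + 1)
  obtain ⟨M, hM⟩ : ∃ M : ℝ, s + C - M ≤ -(c + 1) := ⟨s + C + c + 1, by linarith⟩
  have hlarge : p {z | M < N z} := by
    refine ⟨c + 1, by simp, 1, zero_le_one, fun n => ?_⟩
    have hn : (0 : ℝ) < n := by exact_mod_cast n.pos
    calc ∫⁻ ω in Y n ⁻¹' {z | M < N z}, ENNReal.ofReal (Real.exp (n * f (Y n ω))) ∂μ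
        ≤ ∫⁻ ω in Y n ⁻¹' {z | M < N z}, ENNReal.ofReal (Real.exp (n * (s - M))) *
            ENNReal.ofReal (Real.exp (n * ((s + 1) * N (Y n ω)))) ∂μ := by
          refine setLIntegral_mono ?_ fun ω hω => ?_
          · have := hNcont.measurable.comp (hY n)
            simp only [Function.comp_def] at this
            fun_prop
          · rw [← ENNReal.ofReal_mul (by positivity), ← Real.exp_add]
            have h1 := hfs (Y n ω)
            have h2 : M < N (Y n ω) := hω
            apply ENNReal.ofReal_le_ofReal
            apply Real.exp_le_exp.2
            rw [← mul_add]
            gcongr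
            linarith
      _ ≤ ∫⁻ ω, ENNReal.ofReal (Real.exp (n * (s - M))) *
            ENNReal.ofReal (Real.exp (n * ((s + 1) * N (Y n ω)))) ∂μ :=
          setLIntegral_le_lintegral _ _
      _ ≤ ENNReal.ofReal (Real.exp (n * (s - M))) * ENNReal.ofReal (Real.exp (n * C)) := by
          rw [lintegral_const_mul' _ _ ENNReal.ofReal_ne_top]
          gcongr
          exact hC n
      _ ≤ _ := by
          rw [← ENNReal.ofReal_mul (by positivity), ← Real.exp_add]
          apply ENNReal.ofReal_le_ofReal
          rw [one_mul]
          apply Real.exp_le_exp.2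
          nlinarith
  have hcompact : p (F ∩ {z | N z ≤ M}) := by
    refine ((hNcpt M).inter_left hF).induction_on (p := p) ?_ hmono hunion ?_
    · exact ⟨c + 1, by simp, 0, le_rfl, fun n => by simp⟩
    · rintro z ⟨hz, -⟩
      obtain ⟨l, hl, hlz⟩ := hc z hz
      obtain ⟨c', hc', hlz'⟩ := exists_between hlz
      have hcont := hLcont l hl
      -- On this neighbourhood `exp (n f) ≤ exp (-n c') exp (n l)`, and the integral of the last
      -- factor is bounded in `n`.
      refine ⟨{w | c' < l w - f w}, mem_nhdsWithin_of_mem_nhds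
        ((isOpen_lt continuous_const (hcont.sub hf)).mem_nhds hlz'), c', hc', ?_⟩
      obtain ⟨C, hC⟩ := hL l hl
      refine ⟨max C 0, le_max_right _ _, fun n => ?_⟩
      calc ∫⁻ ω in Y n ⁻¹' {w | c' < l w - f w}, ENNReal.ofReal (Real.exp (n * f (Y n ω))) ∂μ
        _ ≤ ∫⁻ ω in Y n ⁻¹' {w | c' < l w - f w}, ENNReal.ofReal (Real.exp (-(n * c'))) *
              ENNReal.ofReal (Real.exp (n * l (Y n ω))) ∂μ := by
            refine setLIntegral_mono ?_ fun ω hω => ?_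
            · have := hcont.measurable.comp (hY n)
              simp only [Function.comp_def] at this
              fun_prop
            · rw [← ENNReal.ofReal_mul (by positivity), ← Real.exp_add]
              have h2 : c' < l (Y n ω) - f (Y n ω) := hω
              apply ENNReal.ofReal_le_ofReal
              apply Real.exp_le_exp.2
              have hn : (0 : ℝ) < n := by exact_mod_cast n.pos
              nlinarith
        _ ≤ ∫⁻ ω, ENNReal.ofReal (Real.exp (-(n * c'))) *
              ENNReal.ofReal (Real.exp (n * l (Y n ω))) ∂μ := setLIntegral_le_lintegral _ _
        _ ≤ ENNReal.ofReal (Real.exp (-(n * c'))) * ENNReal.ofReal C := by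
            rw [lintegral_const_mul' _ _ ENNReal.ofReal_ne_top]
            gcongr
            exact hC n
        _ ≤ _ := by
            rw [← ENNReal.ofReal_mul (by positivity), mul_comm]
            apply ENNReal.ofReal_le_ofReal
            gcongr
            exact le_max_left _ _
  obtain ⟨c', hc', C, -, h⟩ := hmono F (F ∩ {z | N z ≤ M} ∪ {z | M < N z})
    (fun z hz => (le_or_gt (N z) M).imp (fun h => ⟨hz, h⟩) id) (hunion _ _ hcompact hlarge)
  exact ⟨c', hc', C, h⟩

lemma eventually_mul_exp_le (C : ℝ) {δ ε : ℝ} (hδ : 0 < δ) (hε : 0 < ε) :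
    ∀ᶠ n : ℕ+ in atTop, C * Real.exp (-(n * δ)) ≤ ε := by
  have h1 : Tendsto (fun n : ℕ+ => (n : ℝ)) atTop atTop :=
    tendsto_natCast_atTop_atTop.comp tendsto_PNat_val_atTop_atTop
  have h2 : Tendsto (fun n : ℕ+ => C * Real.exp (-(n * δ))) atTop (𝓝 (C * 0)) :=
    (Real.tendsto_exp_neg_atTop_nhds_zero.comp (h1.atTop_mul_const hδ)).const_mul C
  rw [mul_zero] at h2
  exact (h2.eventually_lt_const hε).mono fun _ h => h.le

lemma log_div_le_of_le {a : ℝ≥0∞} {n : ℕ+} {c : ℝ}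
    (h : a ≤ ENNReal.ofReal (Real.exp (n * c))) :
    ENNReal.log a / ((n : ℝ) : EReal) ≤ c := by
  have hn : (0 : ℝ) < n := by exact_mod_cast n.pos
  have h1 := ENNReal.log_monotone h
  rw [ENNReal.log_ofReal_of_pos (Real.exp_pos _), Real.log_exp] at h1
  refine (EReal.div_le_iff_le_mul (by exact_mod_cast hn) (EReal.coe_ne_top _)).2 ?_
  rwa [← EReal.coe_mul]

lemma le_log_div_of_le {a : ℝ≥0∞} {n : ℕ+} {c : ℝ}
    (h : ENNReal.ofReal (Real.exp (n * c)) ≤ a) :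
    c ≤ ENNReal.log a / ((n : ℝ) : EReal) := by
  have hn : (0 : ℝ) < n := by exact_mod_cast n.pos
  have h1 := ENNReal.log_monotone h
  rw [ENNReal.log_ofReal_of_pos (Real.exp_pos _), Real.log_exp] at h1
  refine (EReal.le_div_iff_mul_le (by exact_mod_cast hn) (EReal.coe_ne_top _)).2 ?_
  rwa [← EReal.coe_mul, mul_comm]

/-- A large-deviation principle from a family of exponentially integrable continuous functions
whose supremum is the rate functional, and sufficiently many exposed points. -/
theorem satisfiesLDP_of_exposed (Y : ℕ+ → Ω → E) (hY : ∀ n, Measurable (Y n))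
    (N : E → ℝ) (hNcont : Continuous N) (hNcpt : ∀ M, IsCompact {z | N z ≤ M})
    (L : Set (E → ℝ)) (hLcont : ∀ l ∈ L, Continuous l)
    (hL : ∀ l ∈ L, ∃ C : ℝ, ∀ n : ℕ+,
      ∫⁻ ω, ENNReal.ofReal (Real.exp (n * l (Y n ω))) ∂μ ≤ ENNReal.ofReal C)
    (hN : ∀ s : ℝ, ∃ C : ℝ, ∀ n : ℕ+,
      ∫⁻ ω, ENNReal.ofReal (Real.exp (n * (s * N (Y n ω)))) ∂μ ≤
        ENNReal.ofReal (Real.exp (n * C)))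
    (hgrowth : ∀ l ∈ L, ∃ s, ∀ z, l z ≤ s + s * N z)
    (I : E → EReal) (hIle : ∀ l ∈ L, ∀ z, (l z : EReal) ≤ I z)
    (hIlt : ∀ z (c : ℝ), c < I z → ∃ l ∈ L, c < l z)
    (hLzero : (fun _ => 0) ∈ L) (hIN : ∃ C : ℝ, ∀ z, ∃ l ∈ L, N z - C ≤ l z)
    (happrox : ∀ z, ∀ r : ℝ, I z ≤ r → ∀ U ∈ 𝓝 z, ∀ ε > 0, ∃ l ∈ L, ∃ z' ∈ U,
      l z' ≤ r + ε ∧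
      (∀ n : ℕ+, 1 ≤ ∫⁻ ω, ENNReal.ofReal (Real.exp (n * l (Y n ω))) ∂μ) ∧
      ∀ w, w ≠ z' → ∃ l' ∈ L, l w < l' w) :
    SatisfiesLDP μ Y I := by
  have hlsc : LowerSemicontinuous I := by
    intro z y hy
    obtain ⟨c, hyc, hcI⟩ := EReal.lt_iff_exists_real_btwn.1 hy
    obtain ⟨l, hl, hlz⟩ := hIlt z c hcI
    filter_upwards [(hLcont l hl).continuousAt.eventually_const_lt hlz] with w hw
    exact hyc.trans_le ((EReal.coe_le_coe_iff.2 hw.le).trans (hIle l hl w))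
  refine ⟨fun z => by simpa using hIle _ hLzero z, hlsc, fun c => ?_, fun B hB => ?_,
    fun B hB => ?_⟩
  · obtain ⟨C, hC⟩ := hIN
    refine (hNcpt (c + C)).of_isClosed_subset (hlsc.isClosed_preimage _) fun z hz => ?_
    obtain ⟨l, hl, hlz⟩ := hC z
    have : l z ≤ c := EReal.coe_le_coe_iff.1 ((hIle l hl z).trans hz)
    change N z ≤ c + C
    linarith
  · rw [EReal.neg_le]
    refine le_iInf₂ fun z hz => EReal.le_of_forall_lt_iff_le.1 fun r hr => ?_
    rw [EReal.neg_le, ← EReal.coe_neg]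
    refine EReal.ge_of_forall_gt_iff_ge.1 fun a ha => ?_
    obtain ⟨ε, hε, hεa⟩ : ∃ ε : ℝ, 0 < ε ∧ a + 3 * ε = -r :=
      ⟨(-r - a) / 3, by have := EReal.coe_lt_coe_iff.1 ha; linarith, by ring⟩
    obtain ⟨l, hl, z', hz', hlz', hone, hexp⟩ := happrox z r hr.le (interior B)
      (isOpen_interior.mem_nhds hz) ε hε
    have hlc := hLcont l hl
    obtain ⟨s, hs⟩ := hgrowth l hl
    -- On `U` the tilting density is at most `exp (n (r + 2 ε))`, so tilted mass in `U` converts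
    -- into untilted probability.
    set U : Set E := interior B ∩ {w | l w < r + 2 * ε} with hU
    have hUo : IsOpen U := isOpen_interior.inter (isOpen_lt hlc continuous_const)
    have hzU : z' ∈ U := ⟨hz', by change l z' < _; linarith⟩
    obtain ⟨δ, hδ, C, hC⟩ := exists_setLIntegral_exp_le Y hY N hNcont hNcpt L hLcont hL hN l hlc s
      -- Exposedness gives gain `c = 0` strictly at each point of the closed set `Uᶜ`; compactness
      -- upgrades this to a positive exponential rate `δ`.
      hs Uᶜ hUo.isClosed_compl 0 fun w hw => by
        obtain ⟨l', hl', h⟩ := hexp w (fun h => hw (h ▸ hzU))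
        exact ⟨l', hl', by linarith⟩
    refine le_liminf_of_le (by isBoundedDefault) ?_
    filter_upwards [eventually_mul_exp_le C hδ (ε := 1 / 2) (by norm_num),
      eventually_mul_exp_le 1 hε (ε := 1 / 2) (by norm_num)] with n hn hn'
    refine le_log_div_of_le ?_
    have hnpos : (0 : ℝ) < n := by exact_mod_cast n.pos
    have h1 : (1 : ℝ≥0∞) ≤ ENNReal.ofReal (Real.exp (n * (r + 2 * ε))) * μ (Y n ⁻¹' B) +
        ENNReal.ofReal (1 / 2) := by
      refine (hone n).trans ?_
      rw [← lintegral_add_compl _ (hUo.measurableSet.preimage (hY n))]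
      refine add_le_add ?_ ((hC n).trans (ENNReal.ofReal_le_ofReal hn))
      calc ∫⁻ ω in Y n ⁻¹' U, ENNReal.ofReal (Real.exp (n * l (Y n ω))) ∂μ
          ≤ ∫⁻ ω in Y n ⁻¹' U, ENNReal.ofReal (Real.exp (n * (r + 2 * ε))) ∂μ := by
            refine setLIntegral_mono measurable_const fun ω hω => ?_
            have : l (Y n ω) < r + 2 * ε := hω.2
            gcongr
        _ = ENNReal.ofReal (Real.exp (n * (r + 2 * ε))) * μ (Y n ⁻¹' U) :=
            setLIntegral_const _ _
        _ ≤ _ := by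
            gcongr
            exact Set.inter_subset_left.trans interior_subset
    by_contra hcon
    rw [not_le] at hcon
    have h2 : ENNReal.ofReal (Real.exp (n * (r + 2 * ε))) * μ (Y n ⁻¹' B) <
        ENNReal.ofReal (1 / 2) := by
      calc _ < ENNReal.ofReal (Real.exp (n * (r + 2 * ε))) *
            ENNReal.ofReal (Real.exp (n * a)) := by
            refine (ENNReal.mul_lt_mul_iff_right ?_ ENNReal.ofReal_ne_top).2 hcon
            exact (ENNReal.ofReal_pos.2 (Real.exp_pos _)).ne'
        _ ≤ _ := by
            rw [← ENNReal.ofReal_mul (by positivity), ← Real.exp_add]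
            apply ENNReal.ofReal_le_ofReal
            rw [one_mul] at hn'
            refine le_trans (le_of_eq ?_) hn'
            congr 1
            rw [show a = -r - 3 * ε by linarith]
            ring
    have h3 := ENNReal.add_lt_add_right (ENNReal.ofReal_ne_top (r := 1 / 2)) h2
    rw [← ENNReal.ofReal_add (by norm_num) (by norm_num)] at h3
    norm_num at h3 h1
    exact absurd h1 (not_le.2 h3)
  · rw [EReal.le_neg]
    refine EReal.ge_of_forall_gt_iff_ge.1 fun c hc => ?_
    rw [EReal.le_neg, ← EReal.coe_neg]
    obtain ⟨c', hc', C, hC⟩ := exists_setLIntegral_exp_le Y hY N hNcont hNcpt L hLcont hL hN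
      (fun _ => 0) continuous_const 0 (by simp) (closure B) isClosed_closure c fun w hw => by
        simpa using hIlt w c (hc.trans_le (iInf₂_le w hw))
    refine limsup_le_of_le (by isBoundedDefault) ?_
    filter_upwards [eventually_mul_exp_le C (sub_pos.2 hc') (ε := 1) (by norm_num)] with n hn
    refine log_div_le_of_le ?_
    have h1 := hC n
    simp only [mul_zero, Real.exp_zero, ENNReal.ofReal_one, setLIntegral_const, one_mul] at h1
    refine (measure_mono (Set.preimage_mono subset_closure)).trans (h1.trans ?_)
    apply ENNReal.ofReal_le_ofReal
    calc C * Real.exp (-(n * c')) = C * Real.exp (-(n * (c' - c))) * Real.exp (n * -c) := by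
          rw [mul_assoc, ← Real.exp_add]
          ring_nf
      _ ≤ 1 * Real.exp (n * -c) := by gcongr
      _ = _ := one_mul _

end Abstract

/-! ### Log-moment generating functions, tilted means and exponential moments. -/

section Cumulant

variable {d : ℕ} {q : Measure (Fin d → ℝ)}

/-- All exponential moments of the `ℓ¹`-norm are finite. -/
def HasExpMoments (q : Measure (Fin d → ℝ)) : Prop :=
  ∀ s : ℝ, Integrable (fun a => Real.exp (s * ∑ i, |a i|)) q

/-- The real-valued log-moment generating function. -/
noncomputable def cumulant (q : Measure (Fin d → ℝ)) (l : Fin d → ℝ) : ℝ :=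
  Real.log (∫ a, Real.exp (l ⬝ᵥ a) ∂q)

/-- The mean of the exponential tilt of `q` by `l`. -/
noncomputable def tiltedMean (q : Measure (Fin d → ℝ)) (l : Fin d → ℝ) (i : Fin d) : ℝ :=
  ∫ a, a i ∂(q.tilted (fun a => l ⬝ᵥ a))

lemma measurable_dotProduct (l : Fin d → ℝ) : Measurable fun a : Fin d → ℝ => l ⬝ᵥ a := by
  simp only [dotProduct]
  fun_prop

lemma dotProduct_le_mul_sum_abs {l : Fin d → ℝ} {s : ℝ} (hs : ∀ i, |l i| ≤ s) (a : Fin d → ℝ) :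
    l ⬝ᵥ a ≤ s * ∑ i, |a i| := by
  rw [dotProduct, Finset.mul_sum]
  refine Finset.sum_le_sum fun i _ => (le_abs_self _).trans ?_
  rw [abs_mul]
  gcongr
  exact hs i

lemma HasExpMoments.integrable_exp_dotProduct (hq : HasExpMoments q) (l : Fin d → ℝ) :
    Integrable (fun a => Real.exp (l ⬝ᵥ a)) q := by
  refine (hq ‖l‖).mono' (measurable_dotProduct l).exp.aestronglyMeasurable
    (Eventually.of_forall fun a => ?_)
  rw [Real.norm_eq_abs, Real.abs_exp]
  exact Real.exp_le_exp.2 (dotProduct_le_mul_sum_abs (fun i => norm_le_pi_norm l i) a)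

lemma HasExpMoments.integral_exp_pos [IsProbabilityMeasure q] (hq : HasExpMoments q)
    (l : Fin d → ℝ) : 0 < ∫ a, Real.exp (l ⬝ᵥ a) ∂q :=
  MeasureTheory.integral_exp_pos (hq.integrable_exp_dotProduct l)

lemma HasExpMoments.exp_cumulant [IsProbabilityMeasure q] (hq : HasExpMoments q)
    (l : Fin d → ℝ) : Real.exp (cumulant q l) = ∫ a, Real.exp (l ⬝ᵥ a) ∂q :=
  Real.exp_log (hq.integral_exp_pos l)

lemma HasExpMoments.lintegral_exp [IsProbabilityMeasure q] (hq : HasExpMoments q)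
    (l : Fin d → ℝ) :
    ∫⁻ a, ENNReal.ofReal (Real.exp (l ⬝ᵥ a)) ∂q = ENNReal.ofReal (Real.exp (cumulant q l)) := by
  rw [hq.exp_cumulant, ofReal_integral_eq_lintegral_ofReal (hq.integrable_exp_dotProduct l)
    (Eventually.of_forall fun a => (Real.exp_pos _).le)]

lemma HasExpMoments.logMGF_eq [IsProbabilityMeasure q] (hq : HasExpMoments q)
    (l : Fin d → ℝ) : logMGF q l = cumulant q l := by
  rw [logMGF, hq.lintegral_exp, ENNReal.log_ofReal_of_pos (Real.exp_pos _), Real.log_exp]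

@[simp] lemma cumulant_zero [IsProbabilityMeasure q] : cumulant q 0 = 0 := by
  simp [cumulant]

lemma HasExpMoments.continuous_cumulant [IsProbabilityMeasure q] (hq : HasExpMoments q) :
    Continuous (cumulant q) := by
  refine Continuous.log ?_ fun l => (hq.integral_exp_pos l).ne'
  refine continuous_iff_continuousAt.2 fun l => ?_
  refine continuousAt_of_dominated (bound := fun a => Real.exp ((‖l‖ + 1) * ∑ i, |a i|))
    (Eventually.of_forall fun l => (measurable_dotProduct l).exp.aestronglyMeasurable) ?_
    (hq _) (Eventually.of_forall fun a => ?_)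
  · filter_upwards [continuous_norm.continuousAt.eventually_lt_const (lt_add_one ‖l‖)] with m hm
    refine Eventually.of_forall fun a => ?_
    rw [Real.norm_eq_abs, Real.abs_exp]
    exact Real.exp_le_exp.2
      (dotProduct_le_mul_sum_abs (fun i => (norm_le_pi_norm m i).trans hm.le) a)
  · simp only [dotProduct]
    have : Continuous fun x : Fin d → ℝ => ∑ i, x i * a i :=
      continuous_finsetSum _ fun i _ => by fun_prop
    exact this.rexp.continuousAt

/-- Along a coordinate direction, the cumulant is a constant plus the cumulant generating function
of that coordinate under the tilted law, whose derivative at `0` is the mean. -/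
lemma HasExpMoments.hasDerivAt_cumulant [IsProbabilityMeasure q] (hq : HasExpMoments q)
    (l : Fin d → ℝ) (i : Fin d) :
    HasDerivAt (fun t : ℝ => cumulant q (l + t • Pi.single i 1)) (tiltedMean q l i) 0 := by
  set ν := q.tilted (fun a => l ⬝ᵥ a) with hν
  have hexp : ∀ (t : ℝ) (a : Fin d → ℝ),
      (l + t • Pi.single i 1) ⬝ᵥ a = l ⬝ᵥ a + t * a i := fun t a => by
    simp [add_dotProduct, smul_dotProduct]
  have : IsProbabilityMeasure ν := isProbabilityMeasure_tilted (hq.integrable_exp_dotProduct l)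
  have hset : integrableExpSet (fun a : Fin d → ℝ => a i) ν = Set.univ := by
    refine Set.eq_univ_of_forall fun t => ?_
    rw [integrableExpSet, Set.mem_ofPred_eq, hν, integrable_tilted_iff]
    · have := hq.integrable_exp_dotProduct (l + t • Pi.single i 1)
      simpa only [hexp, Real.exp_add, smul_eq_mul] using this
    · exact hq.integrable_exp_dotProduct l
  have hcgf : ∀ t, cumulant q (l + t • Pi.single i 1) =
      cgf (fun a : Fin d → ℝ => a i) ν t + cumulant q l := fun t => by
    rw [cgf, mgf, hν, integral_exp_tilted, cumulant, cumulant, Real.log_div]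
    · simp [hexp]
    · have := (hq.integral_exp_pos (l + t • Pi.single i 1)).ne'
      simpa only [hexp, Pi.add_apply] using this
    · exact (hq.integral_exp_pos l).ne'
  have h0 : (0 : ℝ) ∈ interior (integrableExpSet (fun a : Fin d → ℝ => a i) ν) := by
    simp [hset]
  have h1 := (hasDerivAt_mgf h0).log (by simp)
  simp only [zero_mul, Real.exp_zero, mul_one, mgf_zero, div_one] at h1
  simp only [hcgf]
  exact h1.add_const _

/-- Jensen's inequality, obtained by integrating the tangent line of `exp` at the mean. It makes the
Legendre transform vanish at the untilted mean. -/
lemma HasExpMoments.dotProduct_mean_le [IsProbabilityMeasure q] (hq : HasExpMoments q)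
    (l : Fin d → ℝ) : l ⬝ᵥ tiltedMean q 0 ≤ cumulant q l := by
  rw [← Real.exp_le_exp, hq.exp_cumulant]
  have hint : ∀ i, Integrable (fun a : Fin d → ℝ => a i) q := fun i => by
    refine (hq 1).mono' (measurable_pi_apply i).aestronglyMeasurable (Eventually.of_forall fun a => ?_)
    rw [Real.norm_eq_abs, one_mul]
    refine (Finset.single_le_sum (f := fun i => |a i|) (fun _ _ => abs_nonneg _)
      (Finset.mem_univ i)).trans ?_
    linarith [Real.add_one_le_exp (∑ i, |a i|)]
  have hmean : ∀ i, tiltedMean q 0 i = ∫ a, a i ∂q := fun i => by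
    simp [tiltedMean]
  have hdot : l ⬝ᵥ tiltedMean q 0 = ∫ a, l ⬝ᵥ a ∂q := by
    simp only [dotProduct]
    rw [integral_finsetSum _ fun i _ => (hint i).const_mul _]
    simp [hmean, integral_const_mul]
  have hdint : Integrable (fun a => l ⬝ᵥ a) q := by
    simp only [dotProduct]
    exact integrable_finsetSum _ fun i _ => (hint i).const_mul _
  set c := l ⬝ᵥ tiltedMean q 0 with hc
  have h1 : ∫ a, Real.exp c * (l ⬝ᵥ a - c + 1) ∂q ≤ ∫ a, Real.exp (l ⬝ᵥ a) ∂q := by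
    refine integral_mono (((hdint.sub (integrable_const _)).add (integrable_const _)).const_mul _)
      (hq.integrable_exp_dotProduct l) fun a => ?_
    have := Real.add_one_le_exp (l ⬝ᵥ a - c)
    calc Real.exp c * (l ⬝ᵥ a - c + 1) ≤ Real.exp c * Real.exp (l ⬝ᵥ a - c) := by gcongr
      _ = _ := by rw [← Real.exp_add]; ring_nf
  refine le_trans (le_of_eq ?_) h1
  have h2 : Integrable (fun a => l ⬝ᵥ a - c) q := hdint.sub (integrable_const _)
  rw [integral_const_mul, integral_add h2 (integrable_const _),
    integral_sub hdint (integrable_const _), ← hdot]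
  simp

/-- A point with finite Legendre transform is approximated by means of exponential tilts, without
increasing the linear part. -/
lemma HasExpMoments.exists_tiltedMean_near [IsProbabilityMeasure q] (hq : HasExpMoments q)
    (a : Fin d → ℝ) (B : ℝ) (hB : ∀ l : Fin d → ℝ, l ⬝ᵥ a - cumulant q l ≤ B)
    {η : ℝ} (hη : 0 < η) :
    ∃ l : Fin d → ℝ, (∀ i, |tiltedMean q l i - a i| ≤ η) ∧
      l ⬝ᵥ tiltedMean q l ≤ l ⬝ᵥ a := by
  have hB0 : 0 ≤ B := by simpa using hB 0
  set δ : ℝ := η ^ 2 / (2 * (B + 1)) with hδ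
  have hδ0 : 0 < δ := by positivity
  -- The supremum defining the Legendre transform need not be attained. The quadratic penalty makes
  -- `f` coercive, and criticality of its minimiser reads `tiltedMean q l = a - δ • l`; the sign of
  -- the error gives the inequality on the linear part.
  set f : (Fin d → ℝ) → ℝ := fun l => cumulant q l - l ⬝ᵥ a + δ / 2 * (l ⬝ᵥ l) with hf
  have hfc : Continuous f := by
    have := hq.continuous_cumulant
    simp only [hf, dotProduct]
    fun_prop
  have hfl : ∀ l, δ / 2 * (l ⬝ᵥ l) - B ≤ f l := fun l => by
    have := hB l
    simp only [hf]
    linarith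
  have hsq : ∀ (l : Fin d → ℝ) i, l i ^ 2 ≤ l ⬝ᵥ l := fun l i => by
    rw [dotProduct]
    refine le_trans (le_of_eq (by ring)) (Finset.single_le_sum (f := fun i => l i * l i)
      (fun i _ => mul_self_nonneg _) (Finset.mem_univ i))
  have hnorm : ∀ l : Fin d → ℝ, ‖l‖ ≤ 1 + l ⬝ᵥ l := fun l => by
    have h0 : 0 ≤ l ⬝ᵥ l := Finset.sum_nonneg fun i _ => mul_self_nonneg _
    refine (pi_norm_le_iff_of_nonneg (by linarith)).2 fun i => ?_
    rw [Real.norm_eq_abs]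
    have := hsq l i
    have h2 := sq_abs (l i)
    nlinarith [sq_nonneg (|l i| - 1)]
  obtain ⟨l, hl⟩ := hfc.exists_forall_le' (x₀ := 0) (by
    filter_upwards [(tendsto_norm_cocompact_atTop (E := Fin d → ℝ)).eventually_ge_atTop
      (1 + 2 * B / δ)] with l hl
    refine le_trans ?_ (hfl l)
    have h1 := hnorm l
    have h2 : δ / 2 * (2 * B / δ) ≤ δ / 2 * (l ⬝ᵥ l) := by
      gcongr
      linarith
    have h3 : δ / 2 * (2 * B / δ) = B := by field_simp
    simp only [hf, cumulant_zero, zero_dotProduct]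
    linarith)
  have hmean : ∀ i, tiltedMean q l i = a i - δ * l i := fun i => by
    have hdot : ∀ (t : ℝ) (b : Fin d → ℝ),
        (l + t • Pi.single i 1) ⬝ᵥ b = l ⬝ᵥ b + t * b i := fun t b => by
      simp [add_dotProduct, smul_dotProduct]
    have hdot2 : ∀ t : ℝ, (l + t • Pi.single i 1) ⬝ᵥ (l + t • Pi.single i 1) =
        l ⬝ᵥ l + 2 * t * l i + t ^ 2 := fun t => by
      rw [hdot, dotProduct_comm, hdot]
      simp
      ring
    have hd : HasDerivAt (fun t : ℝ => f (l + t • Pi.single i 1))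
        (tiltedMean q l i - a i + δ * l i) 0 := by
      simp only [hf, hdot2]
      simp only [hdot]
      have e1 : HasDerivAt (fun t : ℝ => l ⬝ᵥ a + t * a i) (a i) 0 := by
        simpa using ((hasDerivAt_id (0 : ℝ)).mul_const (a i)).const_add (l ⬝ᵥ a)
      have e2 : HasDerivAt (fun t : ℝ => δ / 2 * (l ⬝ᵥ l + 2 * t * l i + t ^ 2)) (δ * l i) 0 := by
        have := (((((hasDerivAt_id (0 : ℝ)).const_mul 2).mul_const (l i)).const_add
          (l ⬝ᵥ l)).add ((hasDerivAt_id (0 : ℝ)).pow 2)).const_mul (δ / 2)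
        refine (this.congr_deriv ?_)
        simp
        ring
      exact ((hq.hasDerivAt_cumulant l i).sub e1).add e2
    have hmin : IsLocalMin (fun t : ℝ => f (l + t • Pi.single i 1)) 0 :=
      Eventually.of_forall fun t => by simpa using hl _
    have := hmin.hasDerivAt_eq_zero hd
    linarith
  refine ⟨l, fun i => ?_, ?_⟩
  -- Comparing the minimiser with `0`, where `f` vanishes, bounds the penalty by `B`; hence `(δ * l
  -- i) ^ 2 ≤ 2 * B * δ ≤ η ^ 2` by the choice of `δ`.
  · have h1 : δ / 2 * (l ⬝ᵥ l) ≤ B := by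
      have h2 := hfl l
      have h3 := hl 0
      simp only [hf, cumulant_zero, zero_dotProduct] at h2 h3
      linarith
    rw [hmean, sub_sub_cancel_left, abs_neg]
    refine abs_le_of_sq_le_sq ?_ hη.le
    calc (δ * l i) ^ 2 = δ * (δ * l i ^ 2) := by ring
      _ ≤ δ * (δ * (l ⬝ᵥ l)) := by gcongr; exact hsq l i
      _ ≤ δ * (2 * B) := mul_le_mul_of_nonneg_left (by linarith) hδ0.le
      _ ≤ δ * (2 * (B + 1)) := by gcongr; linarith
      _ = η ^ 2 := by rw [hδ]; field_simp
  · have : tiltedMean q l = a - δ • l := funext fun i => by simp [hmean]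
    rw [this, dotProduct_sub, dotProduct_smul]
    have h0 : 0 ≤ l ⬝ᵥ l := Finset.sum_nonneg fun i _ => mul_self_nonneg _
    have : 0 ≤ δ * (l ⬝ᵥ l) := by positivity
    rw [smul_eq_mul]
    linarith

/-- Superlinear growth of the Legendre transform of the log-moment generating function of the norm
forces all exponential moments to be finite. -/
lemma hasExpMoments_of_growth [IsProbabilityMeasure q]
    (h : liminf (fun r : ℝ => logMGFNormConj q r / (r : EReal)) atTop = ⊤) :
    HasExpMoments q := by
  by_contra hcon
  simp only [HasExpMoments, not_forall] at hcon
  obtain ⟨s₀, hs₀⟩ := hcon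
  have hmeas : ∀ s : ℝ, Measurable fun a : Fin d → ℝ => Real.exp (s * ∑ i, |a i|) := fun s => by
    fun_prop
  set S : (Fin d → ℝ) → ℝ := fun a => ∑ i, |a i| with hS
  have hS0 : ∀ a, 0 ≤ S a := fun a => Finset.sum_nonneg fun _ _ => abs_nonneg _
  have hlog : logMGFNorm q s₀ = ⊤ := by
    rw [logMGFNorm, ENNReal.log_eq_top_iff]
    by_contra hne
    refine hs₀ ⟨(hmeas s₀).aestronglyMeasurable, ?_⟩
    rw [hasFiniteIntegral_iff_ofReal (Eventually.of_forall fun a => (Real.exp_pos _).le)]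
    exact lt_top_iff_ne_top.2 hne
  have hmono : Monotone (logMGFNorm q) := fun s t hst => by
    refine ENNReal.log_monotone (lintegral_mono fun a => ENNReal.ofReal_le_ofReal ?_)
    exact Real.exp_le_exp.2 (mul_le_mul_of_nonneg_right hst (hS0 a))
  have hzero : logMGFNorm q 0 = 0 := by simp [logMGFNorm]
  have hs₀pos : 0 ≤ s₀ := by
    by_contra hneg
    have := hmono (not_le.1 hneg).le
    rw [hlog, hzero] at this
    simp at this
  -- A ball of positive mass bounds `logMGFNorm q s` from below linearly for `s ≤ 0`, which handles
  -- negative `s` in the transform.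
  obtain ⟨R, hR⟩ : ∃ R : ℕ, 0 < q {a | S a ≤ R} := by
    have hU : (⋃ R : ℕ, {a | S a ≤ R}) = Set.univ :=
      Set.eq_univ_of_forall fun a => Set.mem_iUnion.2 (exists_nat_ge (S a))
    by_contra! hc
    have : q (⋃ R : ℕ, {a | S a ≤ R}) = 0 :=
      measure_iUnion_null fun R => le_antisymm (hc R) zero_le
    rw [hU, measure_univ] at this
    exact one_ne_zero this
  set κ : ℝ := (q {a | S a ≤ R}).toReal with hκ
  have hκ0 : 0 < κ := ENNReal.toReal_pos hR.ne' (measure_ne_top _ _)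
  have hneg : ∀ s ≤ 0, ((s * R + Real.log κ : ℝ) : EReal) ≤ logMGFNorm q s := fun s hs => by
    have h1 : ENNReal.ofReal (Real.exp (s * R) * κ) ≤
        ∫⁻ a, ENNReal.ofReal (Real.exp (s * S a)) ∂q := by
      rw [ENNReal.ofReal_mul (by positivity), hκ, ENNReal.ofReal_toReal (measure_ne_top _ _),
        ← setLIntegral_const]
      refine le_trans (setLIntegral_mono ?_ fun a ha => ?_) (setLIntegral_le_lintegral _ _)
      · exact (hmeas s).ennreal_ofReal
      · apply ENNReal.ofReal_le_ofReal
        exact Real.exp_le_exp.2 (mul_le_mul_of_nonpos_left ha hs)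
    have h2 := ENNReal.log_monotone h1
    rwa [ENNReal.log_ofReal_of_pos (by positivity),
      Real.log_mul (Real.exp_pos _).ne' hκ0.ne', Real.log_exp] at h2
  -- If the moment of order `s₀` diverges, every `s ≥ s₀` contributes `⊥` to the transform, so its
  -- growth is at most linear, against the hypothesis.
  have hbound : ∀ᶠ r : ℝ in atTop,
      logMGFNormConj q r / (r : EReal) ≤ ((s₀ + 1 : ℝ) : EReal) := by
    filter_upwards [eventually_ge_atTop (1 : ℝ), eventually_ge_atTop (R : ℝ),
      eventually_ge_atTop (-Real.log κ)] with r hr1 hrR hrκ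
    rw [EReal.div_le_iff_le_mul (by exact_mod_cast (by linarith : (0 : ℝ) < r))
      (EReal.coe_ne_top _), ← EReal.coe_mul]
    refine iSup_le fun s => ?_
    rcases le_total s 0 with hs | hs
    · refine (EReal.sub_le_sub le_rfl (hneg s hs)).trans ?_
      rw [← EReal.coe_sub, EReal.coe_le_coe_iff]
      nlinarith
    rcases le_total s s₀ with hss | hss
    · have h1 := hmono hs
      rw [hzero] at h1
      refine (EReal.sub_le_sub le_rfl h1).trans ?_
      rw [sub_zero, EReal.coe_le_coe_iff]
      nlinarith
    · have h1 := hmono hss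
      rw [hlog, top_le_iff] at h1
      rw [h1]
      simp
  have h1 := liminf_le_limsup (u := fun r : ℝ => logMGFNormConj q r / (r : EReal)) (f := atTop)
  have h2 := limsup_le_of_le (by isBoundedDefault) hbound
  rw [h] at h1
  exact absurd (top_le_iff.1 (h1.trans h2)) (EReal.coe_ne_top _)

end Cumulant

/-! ### Expectations of multiplicative functionals along the chain. -/

section Chain

variable {Ω 𝒳 : Type*} [MeasurableSpace Ω] {μ : Measure Ω} [IsProbabilityMeasure μ]
  [MeasurableSpace 𝒳] [MeasurableSingletonClass 𝒳] {d : ℕ}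
  {P : Matrix 𝒳 𝒳 ℝ} {X : ℕ → Ω → 𝒳} {A : ℕ → Ω → Fin d → ℝ} {q : 𝒳 → 𝒳 → Measure (Fin d → ℝ)}

lemma measurableSet_pathEvent (hX : ∀ m, Measurable (X m)) (n : ℕ) (x : ℕ → 𝒳) :
    MeasurableSet (pathEvent X n x) := by
  simp only [pathEvent, Set.ofPred_forall]
  exact MeasurableSet.iInter fun m => MeasurableSet.iInter fun _ =>
    hX m (measurableSet_singleton _)

lemma lintegral_pi_prod {n : ℕ} (ν : Fin n → Measure (Fin d → ℝ))
    [∀ i, IsProbabilityMeasure (ν i)] (f : Fin n → (Fin d → ℝ) → ℝ≥0∞)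
    (hf : ∀ i, Measurable (f i)) :
    ∫⁻ a, ∏ i, f i (a i) ∂(Measure.pi ν) = ∏ i, ∫⁻ b, f i b ∂(ν i) := by
  have h := lintegral_prod_eq_prod_lintegral_of_indepFun (μ := Measure.pi ν) Finset.univ
    (fun i a => f i (a i)) (iIndepFun_pi (X := f) fun i => (hf i).aemeasurable)
    (fun i => (hf i).comp (measurable_pi_apply i))
  rw [h]
  refine Finset.prod_congr rfl fun i _ => ?_
  rw [← (measurePreserving_eval ν i).lintegral_comp (hf i)]

/-- On a path event the states are frozen, so the integrand depends on the `A (m + 1)` alone, which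
are conditionally independent. -/
lemma lintegral_pathEvent (hX : ∀ m, Measurable (X m)) (hA : ∀ m, 1 ≤ m → Measurable (A m))
    (hq : ∀ x y, IsProbabilityMeasure (q x y)) (hIndep : CondIndepOnTransitions μ X A q)
    (F : 𝒳 → 𝒳 → (Fin d → ℝ) → ℝ≥0∞) (hF : ∀ x y, Measurable (F x y)) (n : ℕ) (x : ℕ → 𝒳) :
    ∫⁻ ω in pathEvent X n x, ∏ m ∈ Finset.range n, F (X m ω) (X (m + 1) ω) (A (m + 1) ω) ∂μ =
      μ (pathEvent X n x) *
        ∏ m ∈ Finset.range n, ∫⁻ a, F (x m) (x (m + 1)) a ∂(q (x m) (x (m + 1))) := by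
  have hS := measurableSet_pathEvent hX n x
  rcases eq_or_ne (μ (pathEvent X n x)) 0 with h0 | h0
  · rw [h0, zero_mul, Measure.restrict_eq_zero.2 h0, lintegral_zero_measure]
  have h1 := hIndep n x h0
  have h2 : ∫⁻ ω, ∏ m : Fin n, F (x m) (x (m + 1)) (A (m + 1) ω) ∂(cond μ (pathEvent X n x)) =
      ∏ m ∈ Finset.range n, ∫⁻ a, F (x m) (x (m + 1)) a ∂(q (x m) (x (m + 1))) := by
    rw [Finset.prod_range, ← lintegral_pi_prod _ _ fun i => hF _ _, ← h1, lintegral_map]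
    · exact Finset.measurable_prod _ fun i _ => (hF _ _).comp (measurable_pi_apply i)
    · exact measurable_pi_lambda _ fun i => hA _ (by lia)
  rw [ProbabilityTheory.cond, lintegral_smul_measure] at h2
  rw [← h2, smul_eq_mul, ← mul_assoc, ENNReal.mul_inv_cancel h0 (measure_ne_top _ _), one_mul]
  refine setLIntegral_congr_fun hS fun ω hω => ?_
  rw [Finset.prod_range]
  refine Finset.prod_congr rfl fun i _ => ?_
  rw [hω i (by lia), hω (i + 1) (by lia)]

variable [Fintype 𝒳] [DecidableEq 𝒳]

lemma measure_pathEvent_succ (hX : ∀ m, Measurable (X m)) (hM : IsMarkovChain μ P X)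
    (n : ℕ) (x : ℕ → 𝒳) :
    μ (pathEvent X (n + 1) x) = μ (pathEvent X n x) * ENNReal.ofReal (P (x n) (x (n + 1))) := by
  have hsplit : pathEvent X (n + 1) x = pathEvent X n x ∩ {ω | X (n + 1) ω = x (n + 1)} := by
    ext ω
    constructor
    · exact fun h => ⟨fun m hm => h m (by lia), h _ le_rfl⟩
    · rintro ⟨h1, h2⟩ m hm
      rcases Nat.le_succ_iff.1 hm with h | rfl
      · exact h1 m h
      · exact h2
  rcases eq_or_ne (μ (pathEvent X n x)) 0 with h0 | h0
  · rw [h0, zero_mul, hsplit]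
    exact measure_mono_null Set.inter_subset_left h0
  · rw [← hM.markov n x _ h0, mul_comm, cond_mul_eq_inter (measurableSet_pathEvent hX n x), hsplit]

/-- The Markov step: split according to the next state. The resulting factor depends only on the
last state `x n`, so uniform bounds on it can be iterated. -/
lemma lintegral_pathEvent_succ (hX : ∀ m, Measurable (X m))
    (hA : ∀ m, 1 ≤ m → Measurable (A m)) (hM : IsMarkovChain μ P X)
    (hq : ∀ x y, IsProbabilityMeasure (q x y)) (hIndep : CondIndepOnTransitions μ X A q)
    (F : 𝒳 → 𝒳 → (Fin d → ℝ) → ℝ≥0∞) (hF : ∀ x y, Measurable (F x y)) (n : ℕ) (x : ℕ → 𝒳) :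
    ∫⁻ ω in pathEvent X n x,
        ∏ m ∈ Finset.range (n + 1), F (X m ω) (X (m + 1) ω) (A (m + 1) ω) ∂μ =
      (∑ y, ENNReal.ofReal (P (x n) y) * ∫⁻ a, F (x n) y a ∂(q (x n) y)) *
        ∫⁻ ω in pathEvent X n x,
          ∏ m ∈ Finset.range n, F (X m ω) (X (m + 1) ω) (A (m + 1) ω) ∂μ := by
  have hunion : pathEvent X n x =
      ⋃ y, pathEvent X (n + 1) (Function.update x (n + 1) y) := by
    ext ω
    simp only [Set.mem_iUnion]
    constructor
    · intro h
      refine ⟨X (n + 1) ω, fun m hm => ?_⟩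
      rcases Nat.le_succ_iff.1 hm with h' | rfl
      · rw [Function.update_of_ne (by lia)]
        exact h m h'
      · simp
    · rintro ⟨y, h⟩ m hm
      have := h m (by lia)
      rwa [Function.update_of_ne (by lia)] at this
  have hdisj : Pairwise (Function.onFun Disjoint
      fun y => pathEvent X (n + 1) (Function.update x (n + 1) y)) := by
    intro y y' hyy
    refine Set.disjoint_left.2 fun ω h h' => hyy ?_
    have h1 := h (n + 1) le_rfl
    have h2 := h' (n + 1) le_rfl
    simp only [Function.update_self] at h1 h2
    exact h1.symm.trans h2
  have hupd : ∀ y, ∀ m ≤ n, Function.update x (n + 1) y m = x m := fun y m hm =>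
    Function.update_of_ne (by lia) _ _
  have hpath : ∀ y, pathEvent X n (Function.update x (n + 1) y) = pathEvent X n x := fun y => by
    ext ω
    exact forall₂_congr fun m hm => by rw [hupd y m hm]
  rw [lintegral_pathEvent hX hA hq hIndep F hF n x]
  conv_lhs => rw [hunion]
  rw [lintegral_iUnion (fun y => measurableSet_pathEvent hX _ _) hdisj, tsum_fintype,
    Finset.sum_mul]
  refine Finset.sum_congr rfl fun y _ => ?_
  rw [lintegral_pathEvent hX hA hq hIndep F hF, measure_pathEvent_succ hX hM, hpath,
    Finset.prod_range_succ, hupd y n le_rfl, Function.update_self]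
  have : ∏ m ∈ Finset.range n, ∫⁻ a, F (Function.update x (n + 1) y m)
        (Function.update x (n + 1) y (m + 1)) a ∂(q (Function.update x (n + 1) y m)
        (Function.update x (n + 1) y (m + 1))) =
      ∏ m ∈ Finset.range n, ∫⁻ a, F (x m) (x (m + 1)) a ∂(q (x m) (x (m + 1))) := by
    refine Finset.prod_congr rfl fun m hm => ?_
    have := Finset.mem_range.1 hm
    rw [hupd y m (by lia), hupd y (m + 1) (by lia)]
  rw [this]
  ring

omit [IsProbabilityMeasure μ] [DecidableEq 𝒳] in
-- `Fin.ofNat` extends a finite path to all of `ℕ` by reduction modulo `n + 1`; a path event ignores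
-- the indices beyond `n`.
lemma lintegral_eq_sum_pathEvent (hX : ∀ m, Measurable (X m)) (n : ℕ) (f : Ω → ℝ≥0∞) :
    ∫⁻ ω, f ω ∂μ = ∑ z : Fin (n + 1) → 𝒳,
      ∫⁻ ω in pathEvent X n (fun m => z (Fin.ofNat (n + 1) m)), f ω ∂μ := by
  have hunion : ⋃ z : Fin (n + 1) → 𝒳, pathEvent X n (fun m => z (Fin.ofNat (n + 1) m)) =
      Set.univ := by
    refine Set.eq_univ_of_forall fun ω => Set.mem_iUnion.2 ⟨fun i => X i ω, fun m hm => ?_⟩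
    simp [Nat.mod_eq_of_lt (Nat.lt_succ_of_le hm)]
  have hdisj : Pairwise (Function.onFun Disjoint
      fun z : Fin (n + 1) → 𝒳 => pathEvent X n (fun m => z (Fin.ofNat (n + 1) m))) := by
    intro z z' hzz
    refine Set.disjoint_left.2 fun ω h h' => hzz (funext fun i => ?_)
    have h1 := h i (by lia)
    have h2 := h' i (by lia)
    simp only [Fin.ofNat_val_eq_self] at h1 h2
    exact h1.symm.trans h2
  calc ∫⁻ ω, f ω ∂μ = ∫⁻ ω in Set.univ, f ω ∂μ := (setLIntegral_univ f).symm
    _ = _ := by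
      rw [← hunion, lintegral_iUnion (fun z => measurableSet_pathEvent hX _ _) hdisj, tsum_fintype]

/-- One-step bound for multiplicative functionals of the transitions. -/
lemma lintegral_prod_le_pow (hX : ∀ m, Measurable (X m))
    (hA : ∀ m, 1 ≤ m → Measurable (A m)) (hM : IsMarkovChain μ P X)
    (hq : ∀ x y, IsProbabilityMeasure (q x y)) (hIndep : CondIndepOnTransitions μ X A q)
    (F : 𝒳 → 𝒳 → (Fin d → ℝ) → ℝ≥0∞) (hF : ∀ x y, Measurable (F x y)) (C : ℝ≥0∞)
    (hC : ∀ x, ∑ y, ENNReal.ofReal (P x y) * ∫⁻ a, F x y a ∂(q x y) ≤ C) (n : ℕ) :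
    ∫⁻ ω, ∏ m ∈ Finset.range n, F (X m ω) (X (m + 1) ω) (A (m + 1) ω) ∂μ ≤ C ^ n := by
  induction n with
  | zero => simp
  | succ n ih =>
    rw [pow_succ']
    refine le_trans ?_ (mul_le_mul_right ih C)
    rw [lintegral_eq_sum_pathEvent hX n, lintegral_eq_sum_pathEvent hX n, Finset.mul_sum]
    refine Finset.sum_le_sum fun z _ => ?_
    rw [lintegral_pathEvent_succ hX hA hM hq hIndep F hF]
    gcongr
    exact hC _

lemma one_le_lintegral_prod (hX : ∀ m, Measurable (X m))
    (hA : ∀ m, 1 ≤ m → Measurable (A m)) (hM : IsMarkovChain μ P X)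
    (hq : ∀ x y, IsProbabilityMeasure (q x y)) (hIndep : CondIndepOnTransitions μ X A q)
    (F : 𝒳 → 𝒳 → (Fin d → ℝ) → ℝ≥0∞) (hF : ∀ x y, Measurable (F x y))
    (hone : ∀ x, 1 ≤ ∑ y, ENNReal.ofReal (P x y) * ∫⁻ a, F x y a ∂(q x y)) (n : ℕ) :
    1 ≤ ∫⁻ ω, ∏ m ∈ Finset.range n, F (X m ω) (X (m + 1) ω) (A (m + 1) ω) ∂μ := by
  induction n with
  | zero => simp
  | succ n ih =>
    refine ih.trans ?_
    rw [lintegral_eq_sum_pathEvent hX n, lintegral_eq_sum_pathEvent hX n]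
    refine Finset.sum_le_sum fun z _ => ?_
    rw [lintegral_pathEvent_succ hX hA hM hq hIndep F hF]
    exact le_mul_of_one_le_left zero_le (hone _)

end Chain

/-! ### The rate functional as a supremum of tilts. -/

section Duality

variable {𝒳 : Type*} [Fintype 𝒳] {d : ℕ}
  {P : Matrix 𝒳 𝒳 ℝ} {q : 𝒳 → 𝒳 → Measure (Fin d → ℝ)}

/-- The linear functional on pairs `(k, θ)` with slope `lam` in `k`, slope `g - φ(lam)` in `θ`, and
the multiplier `u` for the equality of the marginals. -/
noncomputable def tilt (q : 𝒳 → 𝒳 → Measure (Fin d → ℝ)) (lam : 𝒳 × 𝒳 → Fin d → ℝ)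
    (g : 𝒳 × 𝒳 → ℝ) (u : 𝒳 → ℝ) (z : (𝒳 × 𝒳 → Fin d → ℝ) × stdSimplex ℝ (𝒳 × 𝒳)) : ℝ :=
  ∑ p, (lam p ⬝ᵥ z.1 p + z.2.1 p * (g p - cumulant (q p.1 p.2) (lam p) + (u p.1 - u p.2)))

/-- `g` is the logarithm of a substochastic density with respect to `P`. -/
def IsSubdensity (P : Matrix 𝒳 𝒳 ℝ) (g : 𝒳 × 𝒳 → ℝ) : Prop :=
  ∀ x, ∑ y, P x y * Real.exp (g (x, y)) ≤ 1

/-- The family of functionals whose supremum is the rate functional. -/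
def tilts (P : Matrix 𝒳 𝒳 ℝ) (q : 𝒳 → 𝒳 → Measure (Fin d → ℝ)) :
    Set ((𝒳 × 𝒳 → Fin d → ℝ) × stdSimplex ℝ (𝒳 × 𝒳) → ℝ) :=
  {f | ∃ lam g u, IsSubdensity P g ∧ f = tilt q lam g u}

lemma sum_mul_sub_eq (θ : 𝒳 × 𝒳 → ℝ) (u : 𝒳 → ℝ) :
    ∑ p, θ p * (u p.1 - u p.2) = ∑ x, u x * (marginalFst θ x - marginalSnd θ x) := by
  simp only [mul_sub, Finset.sum_sub_distrib, marginalFst, marginalSnd]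
  congr 1
  · rw [Fintype.sum_prod_type]
    refine Finset.sum_congr rfl fun x _ => ?_
    rw [Finset.mul_sum]
    exact Finset.sum_congr rfl fun y _ => mul_comm _ _
  · rw [Fintype.sum_prod_type_right]
    refine Finset.sum_congr rfl fun x _ => ?_
    rw [Finset.mul_sum]
    exact Finset.sum_congr rfl fun y _ => mul_comm _ _

/-- The parameters `lam`, `g` and `u` enter separate blocks, so each can be optimised on its own;
`u` only sees the defect of balance. -/
lemma tilt_eq (lam : 𝒳 × 𝒳 → Fin d → ℝ)
    (g : 𝒳 × 𝒳 → ℝ) (u : 𝒳 → ℝ) (z : (𝒳 × 𝒳 → Fin d → ℝ) × stdSimplex ℝ (𝒳 × 𝒳)) :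
    tilt q lam g u z = ∑ p, (lam p ⬝ᵥ z.1 p - z.2.1 p * cumulant (q p.1 p.2) (lam p)) +
      ∑ p, z.2.1 p * g p + ∑ x, u x * (marginalFst z.2.1 x - marginalSnd z.2.1 x) := by
  rw [tilt, ← sum_mul_sub_eq, ← Finset.sum_add_distrib, ← Finset.sum_add_distrib]
  exact Finset.sum_congr rfl fun p _ => by ring

lemma isSubdensity_zero (hP : ∀ x, ∑ y, P x y = 1) : IsSubdensity P 0 := fun x => by
  simp [hP]

lemma eq_zero_of_forall_mul_le {D B : ℝ} (h : ∀ t : ℝ, t * D ≤ B) : D = 0 := by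
  by_contra hD
  have := h ((B + 1) / D)
  rw [div_mul_cancel₀ _ hD] at this
  linarith

/-! ### Constraints forced by a finite supremum over the tilts. -/

section Bounded

variable {z : (𝒳 × 𝒳 → Fin d → ℝ) × stdSimplex ℝ (𝒳 × 𝒳)} {B : ℝ}

/-- The multiplier at one state can be scaled freely, and a linear function of `t` bounded above has
zero slope. -/
lemma marginal_eq_of_tilt_le [∀ x y, IsProbabilityMeasure (q x y)] (hP : ∀ x, ∑ y, P x y = 1)
    (hB : ∀ f ∈ tilts P q, f z ≤ B) : marginalFst z.2.1 = marginalSnd z.2.1 := by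
  classical
  funext x
  refine sub_eq_zero.1 (eq_zero_of_forall_mul_le (B := B) fun t => ?_)
  have h := hB _ ⟨0, 0, Pi.single x t, isSubdensity_zero hP, rfl⟩
  rw [tilt_eq] at h
  simpa [Pi.single_apply] using h

lemma dotProduct_sub_le_of_tilt_le [∀ x y, IsProbabilityMeasure (q x y)]
    (hP : ∀ x, ∑ y, P x y = 1) (hB : ∀ f ∈ tilts P q, f z ≤ B) (p : 𝒳 × 𝒳) (l : Fin d → ℝ) :
    l ⬝ᵥ z.1 p - z.2.1 p * cumulant (q p.1 p.2) l ≤ B := by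
  classical
  have h := hB _ ⟨Pi.single p l, 0, 0, isSubdensity_zero hP, rfl⟩
  rw [tilt_eq, Finset.sum_eq_single p] at h
  · simpa using h
  · intro p' _ hp'
    simp [Pi.single_eq_of_ne hp']
  · simp

/-- With no mass at `p` the cumulant drops out, leaving a bounded linear function of `l`. -/
lemma eq_zero_of_tilt_le [∀ x y, IsProbabilityMeasure (q x y)]
    (hP : ∀ x, ∑ y, P x y = 1) (hB : ∀ f ∈ tilts P q, f z ≤ B) {p : 𝒳 × 𝒳} (hp : z.2.1 p = 0) :
    z.1 p = 0 := by
  funext i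
  refine eq_zero_of_forall_mul_le (B := B) fun t => ?_
  have h := dotProduct_sub_le_of_tilt_le hP hB p (t • Pi.single i 1)
  simpa [hp, smul_dotProduct] using h

/-- Where `P` vanishes, the value of `g` is unconstrained by substochasticity. -/
lemma theta_eq_zero_of_tilt_le [∀ x y, IsProbabilityMeasure (q x y)]
    (hP : ∀ x, ∑ y, P x y = 1) (hB : ∀ f ∈ tilts P q, f z ≤ B) {p : 𝒳 × 𝒳}
    (hp : P p.1 p.2 = 0) : z.2.1 p = 0 := by
  classical
  refine eq_zero_of_forall_mul_le (B := B) fun t => ?_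
  have hadm : IsSubdensity P (Pi.single p t) := fun x => by
    rw [← hP x]
    refine Finset.sum_le_sum fun y _ => ?_
    by_cases h : (x, y) = p
    · subst h
      simp at hp
      simp [hp]
    · simp [Pi.single_eq_of_ne h]
  have h := hB _ ⟨0, Pi.single p t, 0, hadm, rfl⟩
  rw [tilt_eq] at h
  have h2 : ∑ p', z.2.1 p' * (Pi.single p t : 𝒳 × 𝒳 → ℝ) p' = t * z.2.1 p := by
    rw [Finset.sum_eq_single p]
    · simp [mul_comm]
    · intro p' _ hp'
      simp [Pi.single_eq_of_ne hp']
    · simp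
  rw [h2] at h
  simpa using h

end Bounded

lemma coe_finsetSum {ι : Type*} (s : Finset ι) (f : ι → ℝ) :
    ((∑ i ∈ s, f i : ℝ) : EReal) = ∑ i ∈ s, (f i : EReal) := by
  classical
  induction s using Finset.induction_on with
  | empty => simp
  | insert a s ha ih => rw [Finset.sum_insert ha, Finset.sum_insert ha, EReal.coe_add, ih]

/-- The supremum of a sum of functions of separate variables is the sum of the suprema. It is
phrased with strict lower bounds so that infinite summands need no separate treatment. -/
lemma exists_lt_sum_of_lt_sum {ι β : Type*} [Nonempty β] (s : Finset ι) (f : ι → EReal)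
    (h : ι → β → ℝ) (H : ∀ i, ∀ c : ℝ, c < f i → ∃ l, c < h i l) (c : ℝ)
    (hc : c < ∑ i ∈ s, f i) : ∃ l : ι → β, c < ∑ i ∈ s, h i (l i) := by
  classical
  induction s using Finset.induction_on generalizing c with
  | empty => exact ⟨fun _ => Classical.arbitrary β, by simpa using hc⟩
  | insert a s ha ih =>
    rw [Finset.sum_insert ha] at hc
    obtain ⟨a₁, ha₁, b₁, hb₁, hab⟩ : ∃ a' < f a, ∃ b' < ∑ i ∈ s, f i, (c : EReal) < a' + b' := by
      by_contra! hcon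
      exact absurd (EReal.add_le_of_forall_lt hcon) (not_le.2 hc)
    obtain ⟨a₂, ha₂, ha₂'⟩ := EReal.lt_iff_exists_real_btwn.1 ha₁
    obtain ⟨b₂, hb₂, hb₂'⟩ := EReal.lt_iff_exists_real_btwn.1 hb₁
    obtain ⟨l, hl⟩ := H a a₂ ha₂'
    obtain ⟨m, hm⟩ := ih b₂ hb₂'
    refine ⟨Function.update m a l, ?_⟩
    have h1 := hab.trans_le (add_le_add ha₂.le hb₂.le)
    rw [← EReal.coe_add, EReal.coe_lt_coe_iff] at h1
    have h2 : ∑ i ∈ s, h i (Function.update m a l i) = ∑ i ∈ s, h i (m i) :=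
      Finset.sum_congr rfl fun i hi => by
        rw [Function.update_of_ne (ne_of_mem_of_not_mem hi ha)]
    rw [Finset.sum_insert ha, h2, Function.update_self]
    linarith

/-- Fenchel–Young inequality for `s(· | b)`, from `x + 1 ≤ exp x` at `x = g - log (a / b)`. -/
lemma le_relEnt {a b : ℝ} (hb : 0 ≤ b) (g : ℝ) :
    ((a * g - b * Real.exp g + b : ℝ) : EReal) ≤ relEnt a b := by
  rw [relEnt]
  split_ifs with h1 h2
  · rw [EReal.coe_le_coe_iff]
    have h3 := Real.add_one_le_exp (g - Real.log (a / b))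
    rw [Real.exp_sub, Real.exp_log (div_pos h1.1 h1.2), le_div_iff₀ (div_pos h1.1 h1.2)] at h3
    have h4 := mul_le_mul_of_nonneg_left h3 hb
    have h5 : b * ((g - Real.log (a / b) + 1) * (a / b)) = a * (g - Real.log (a / b) + 1) := by
      field_simp [h1.2.ne']
    rw [h5] at h4
    linarith
  · rw [EReal.coe_le_coe_iff, h2.1]
    have := mul_nonneg hb (Real.exp_pos g).le
    linarith
  · exact le_top

lemma HasExpMoments.logMGFConj_eq {ν : Measure (Fin d → ℝ)} [IsProbabilityMeasure ν]
    (hν : HasExpMoments ν) (a : Fin d → ℝ) :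
    logMGFConj ν a = ⨆ l : Fin d → ℝ, ((l ⬝ᵥ a - cumulant ν l : ℝ) : EReal) := by
  simp only [logMGFConj, hν.logMGF_eq, EReal.coe_sub]

lemma dotProduct_sub_mul_eq {ν : Measure (Fin d → ℝ)} {t : ℝ} (ht : t ≠ 0) (l k : Fin d → ℝ) :
    l ⬝ᵥ k - t * cumulant ν l = t * (l ⬝ᵥ (t⁻¹ • k) - cumulant ν l) := by
  rw [dotProduct_smul, smul_eq_mul, mul_sub, mul_inv_cancel_left₀ ht]

lemma coe_le_conj_term {ν : Measure (Fin d → ℝ)} [IsProbabilityMeasure ν]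
    (hν : HasExpMoments ν) {t : ℝ} (ht : 0 < t) (l k : Fin d → ℝ) :
    ((l ⬝ᵥ k - t * cumulant ν l : ℝ) : EReal) ≤ (t : EReal) * logMGFConj ν (t⁻¹ • k) := by
  rw [dotProduct_sub_mul_eq ht.ne', EReal.coe_mul, hν.logMGFConj_eq]
  exact mul_le_mul_of_nonneg_left
    (le_iSup (fun l : Fin d → ℝ => ((l ⬝ᵥ (t⁻¹ • k) - cumulant ν l : ℝ) : EReal)) l)
    (by exact_mod_cast ht.le)

lemma exists_lt_of_lt_conj_term {ν : Measure (Fin d → ℝ)} [IsProbabilityMeasure ν]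
    (hν : HasExpMoments ν) {t : ℝ} (ht : 0 < t) (k : Fin d → ℝ) {c : ℝ}
    (hc : (c : EReal) < (t : EReal) * logMGFConj ν (t⁻¹ • k)) :
    ∃ l, c < l ⬝ᵥ k - t * cumulant ν l := by
  by_contra! hcon
  refine absurd hc (not_lt.2 ?_)
  have : logMGFConj ν (t⁻¹ • k) ≤ ((c / t : ℝ) : EReal) := by
    rw [hν.logMGFConj_eq]
    refine iSup_le fun l => ?_
    rw [EReal.coe_le_coe_iff, le_div_iff₀' ht, ← dotProduct_sub_mul_eq ht.ne']
    exact hcon l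
  refine (mul_le_mul_of_nonneg_left this (by exact_mod_cast ht.le)).trans ?_
  rw [← EReal.coe_mul, mul_div_cancel₀ _ ht.ne']

/-! ### Both inequalities of the variational formula. -/

section Rate

variable (hP0 : ∀ x y, 0 ≤ P x y) (hP1 : ∀ x, ∑ y, P x y = 1)

lemma marginalFst_nonneg {θ : 𝒳 × 𝒳 → ℝ} (hθ : ∀ p, 0 ≤ θ p) (x : 𝒳) : 0 ≤ marginalFst θ x :=
  Finset.sum_nonneg fun _ _ => hθ _

lemma le_marginalFst {θ : 𝒳 × 𝒳 → ℝ} (hθ : ∀ p, 0 ≤ θ p) (x y : 𝒳) :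
    θ (x, y) ≤ marginalFst θ x :=
  Finset.single_le_sum (f := fun y => θ (x, y)) (fun _ _ => hθ _) (Finset.mem_univ y)

-- Fenchel–Young term by term. Substochasticity makes the row sums of `b - b * exp g` nonnegative,
-- so adding them to the `g` block only increases it.
include hP0 hP1 in
lemma tilt_le_rate [∀ x y, IsProbabilityMeasure (q x y)] (hq : ∀ x y, HasExpMoments (q x y))
    {f} (hf : f ∈ tilts P q) (z : (𝒳 × 𝒳 → Fin d → ℝ) × stdSimplex ℝ (𝒳 × 𝒳)) :
    (f z : EReal) ≤ rate P q z := by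
  obtain ⟨lam, g, u, hg, rfl⟩ := hf
  rw [rate]
  split_ifs with h
  swap
  · exact le_top
  obtain ⟨hk, hm⟩ := h
  have hθ : ∀ p, 0 ≤ z.2.1 p := z.2.2.1
  set b : 𝒳 → 𝒳 → ℝ := fun x y => marginalFst z.2.1 x * P x y with hb
  have hgb : ∑ p, z.2.1 p * g p ≤
      ∑ x, ∑ y, (z.2.1 (x, y) * g (x, y) - b x y * Real.exp (g (x, y)) + b x y) := by
    rw [Fintype.sum_prod_type]
    refine Finset.sum_le_sum fun x _ => ?_
    rw [Finset.sum_add_distrib, Finset.sum_sub_distrib]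
    have h1 : ∑ y, b x y = marginalFst z.2.1 x := by
      rw [← Finset.mul_sum, hP1, mul_one]
    have h2 : ∑ y, b x y * Real.exp (g (x, y)) ≤ marginalFst z.2.1 x := by
      simp only [hb, mul_assoc]
      rw [← Finset.mul_sum]
      exact mul_le_of_le_one_right (marginalFst_nonneg hθ x) (hg x)
    linarith
  have htilt : tilt q lam g u z ≤
      ∑ x, ∑ y, (lam (x, y) ⬝ᵥ z.1 (x, y) - z.2.1 (x, y) * cumulant (q x y) (lam (x, y))) +
      ∑ x, ∑ y, (z.2.1 (x, y) * g (x, y) - b x y * Real.exp (g (x, y)) + b x y) := by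
    rw [tilt_eq, hm]
    simp only [sub_self, mul_zero, Finset.sum_const_zero, add_zero]
    rw [Fintype.sum_prod_type (f := fun p : 𝒳 × 𝒳 =>
      lam p ⬝ᵥ z.1 p - z.2.1 p * cumulant (q p.1 p.2) (lam p))]
    gcongr
  refine (EReal.coe_le_coe_iff.2 htilt).trans ?_
  rw [EReal.coe_add]
  simp only [coe_finsetSum]
  refine add_le_add ?_ ?_
  · refine Finset.sum_le_sum fun x _ => Finset.sum_le_sum fun y _ => ?_
    split_ifs with h0
    · simp [h0, hk _ h0]
    · exact coe_le_conj_term (hq x y) (lt_of_le_of_ne (hθ _) (Ne.symm h0)) _ _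
  · refine Finset.sum_le_sum fun x _ => Finset.sum_le_sum fun y _ => ?_
    exact le_relEnt (mul_nonneg (marginalFst_nonneg hθ x) (hP0 x y)) _

-- If all tilts stay below `c`, the constraints hold and the relative entropy is a finite number
-- `R`; near-optimal `lam` and `g` then contradict the bound.
include hP0 hP1 in
lemma exists_lt_tilt_of_lt_rate [∀ x y, IsProbabilityMeasure (q x y)]
    (hq : ∀ x y, HasExpMoments (q x y))
    (z : (𝒳 × 𝒳 → Fin d → ℝ) × stdSimplex ℝ (𝒳 × 𝒳)) (c : ℝ) (hc : c < rate P q z) :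
    ∃ f ∈ tilts P q, c < f z := by
  by_contra! hcon
  have hm := marginal_eq_of_tilt_le hP1 hcon
  have hk : ∀ p, z.2.1 p = 0 → z.1 p = 0 := fun p => eq_zero_of_tilt_le hP1 hcon
  have hPθ : ∀ p : 𝒳 × 𝒳, P p.1 p.2 = 0 → z.2.1 p = 0 := fun p =>
    theta_eq_zero_of_tilt_le hP1 hcon
  have hθ : ∀ p, 0 ≤ z.2.1 p := z.2.2.1
  have hθ1 : ∑ p, z.2.1 p = 1 := z.2.2.2
  rw [rate, if_pos ⟨hk, hm⟩] at hc
  set b : 𝒳 × 𝒳 → ℝ := fun p => marginalFst z.2.1 p.1 * P p.1 p.2 with hb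
  have hbpos : ∀ p, z.2.1 p ≠ 0 → 0 < b p := fun p hp => by
    refine mul_pos (((lt_of_le_of_ne (hθ p) (Ne.symm hp))).trans_le (le_marginalFst hθ _ _)) ?_
    exact lt_of_le_of_ne (hP0 _ _) fun h => hp (hPθ p h.symm)
  have hsumb : ∑ p, b p = 1 := by
    rw [Fintype.sum_prod_type, ← hθ1, Fintype.sum_prod_type]
    refine Finset.sum_congr rfl fun x _ => ?_
    simp only [hb]
    rw [← Finset.mul_sum, hP1, mul_one, marginalFst]
  set R : ℝ := ∑ p, z.2.1 p * Real.log (z.2.1 p / b p) with hR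
  -- The terms `-a + b` cancel in the sum because `θ` and `b` both have total mass `1`.
  have hrel : ∑ x, ∑ y, relEnt (z.2.1 (x, y)) (marginalFst z.2.1 x * P x y) = (R : EReal) := by
    have h1 : ∀ p : 𝒳 × 𝒳, relEnt (z.2.1 p) (b p) =
        ((z.2.1 p * Real.log (z.2.1 p / b p) - z.2.1 p + b p : ℝ) : EReal) := fun p => by
      rw [relEnt]
      rcases eq_or_ne (z.2.1 p) 0 with h0 | h0
      · have hb0 : 0 ≤ b p := mul_nonneg (marginalFst_nonneg hθ _) (hP0 _ _)
        simp [h0, hb0]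
      · rw [if_pos ⟨lt_of_le_of_ne (hθ p) (Ne.symm h0), hbpos p h0⟩]
    have h2 : ∑ p, (z.2.1 p * Real.log (z.2.1 p / b p) - z.2.1 p + b p) = R := by
      rw [Finset.sum_add_distrib, Finset.sum_sub_distrib, hθ1, hsumb]
      ring
    rw [← h2, coe_finsetSum, Fintype.sum_prod_type]
    exact Finset.sum_congr rfl fun x _ => Finset.sum_congr rfl fun y _ => h1 (x, y)
  rw [hrel] at hc
  have hc' : ((c - R : ℝ) : EReal) < ∑ p : 𝒳 × 𝒳, if z.2.1 p = 0 then (0 : EReal) else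
      (z.2.1 p : EReal) * logMGFConj (q p.1 p.2) ((z.2.1 p)⁻¹ • z.1 p) := by
    rw [Fintype.sum_prod_type, EReal.coe_sub]
    exact EReal.sub_lt_of_lt_add' (by rwa [add_comm])
  obtain ⟨c', hc₁, hc₂⟩ := EReal.lt_iff_exists_real_btwn.1 hc'
  rw [EReal.coe_lt_coe_iff] at hc₁
  obtain ⟨lam, hlam⟩ := exists_lt_sum_of_lt_sum Finset.univ _
    (fun p l => l ⬝ᵥ z.1 p - z.2.1 p * cumulant (q p.1 p.2) l) (fun p c hc => by
      split_ifs at hc with h0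
      · exact ⟨0, by simpa [h0] using hc⟩
      · exact exists_lt_of_lt_conj_term (hq _ _) (lt_of_le_of_ne (hθ p) (Ne.symm h0)) _ hc) c' hc₂
  -- The surplus of the Legendre block pays for making `g` real-valued. The ideal `g = log (θ / b)`
  -- is `-∞` off the support of `θ`; scaling that kernel by `ρ = exp (-γ)` frees mass `1 - ρ` for
  -- the uncharged transitions and costs exactly `γ`.
  set γ : ℝ := c' - (c - R) with hγ
  have hγ0 : 0 < γ := by linarith
  set ρ : ℝ := Real.exp (-γ) with hρ
  have hρ0 : 0 < ρ := Real.exp_pos _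
  have hρ1 : ρ < 1 := by rw [hρ, Real.exp_lt_one_iff]; linarith
  classical
  set g : 𝒳 × 𝒳 → ℝ := fun p =>
    if z.2.1 p = 0 then Real.log (1 - ρ) else Real.log (z.2.1 p / b p) - γ with hg
  have hadm : IsSubdensity P g := fun x => by
    have hterm : ∀ y, P x y * Real.exp (g (x, y)) ≤
        P x y * (1 - ρ) + ρ * (z.2.1 (x, y) / marginalFst z.2.1 x) := fun y => by
      simp only [hg]
      split_ifs with h0
      · rw [Real.exp_log (by linarith), h0]
        simp
      · have hθp : 0 < z.2.1 (x, y) := lt_of_le_of_ne (hθ _) (Ne.symm h0)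
        have hb0 := hbpos _ h0
        have hmp : 0 < marginalFst z.2.1 x := hθp.trans_le (le_marginalFst hθ _ _)
        have hPp : 0 < P x y := lt_of_le_of_ne (hP0 _ _) fun h => h0 (hPθ (x, y) h.symm)
        rw [sub_eq_add_neg, Real.exp_add, Real.exp_log (div_pos hθp hb0), ← hρ]
        have : P x y * (z.2.1 (x, y) / b (x, y) * ρ) =
            ρ * (z.2.1 (x, y) / marginalFst z.2.1 x) := by
          simp only [hb]
          field_simp
        rw [this]
        have := mul_nonneg hPp.le (sub_nonneg.2 hρ1.le)
        linarith
    refine (Finset.sum_le_sum fun y _ => hterm y).trans ?_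
    rw [Finset.sum_add_distrib, ← Finset.sum_mul, hP1, ← Finset.mul_sum, ← Finset.sum_div]
    have : (∑ y, z.2.1 (x, y)) / marginalFst z.2.1 x ≤ 1 := div_self_le_one _
    nlinarith
  have h := hcon _ ⟨lam, g, 0, hadm, rfl⟩
  rw [tilt_eq] at h
  have hsumg : ∑ p, z.2.1 p * g p = R - γ := by
    have : ∀ p, z.2.1 p * g p = z.2.1 p * Real.log (z.2.1 p / b p) - z.2.1 p * γ := fun p => by
      simp only [hg]
      split_ifs with h0
      · simp [h0]
      · ring
    simp only [this]
    rw [Finset.sum_sub_distrib, ← Finset.sum_mul, hθ1, one_mul]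
  rw [hsumg] at h
  simp only [Pi.zero_apply, zero_mul, Finset.sum_const_zero, add_zero] at h
  linarith

end Rate

end Duality

/-! ### Exponential moments of the empirical pair. -/

section EmpiricalBounds

variable {Ω 𝒳 : Type*} [DecidableEq 𝒳] {d : ℕ} {X : ℕ → Ω → 𝒳} {A : ℕ → Ω → Fin d → ℝ}

lemma sum_Icc_one_eq_sum_range {M : Type*} [AddCommMonoid M] (f : ℕ → M) (n : ℕ) :
    ∑ m ∈ Finset.Icc 1 n, f m = ∑ m ∈ Finset.range n, f (m + 1) := by
  have : Finset.Icc 1 n = Finset.Ico (0 + 1) (n + 1) := by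
    ext
    simp
  rw [this, ← Finset.sum_Ico_add', Finset.range_eq_Ico]

lemma empiricalK_eq (n : ℕ+) (ω : Ω) (p : 𝒳 × 𝒳) : empiricalK X A n ω p =
    (n : ℝ)⁻¹ • ∑ m ∈ Finset.range n,
      if (X m ω, X (m + 1) ω) = p then A (m + 1) ω else 0 := by
  rw [empiricalK, sum_Icc_one_eq_sum_range]
  simp

variable [Fintype 𝒳]

lemma empiricalTheta_eq (n : ℕ+) (ω : Ω) (p : 𝒳 × 𝒳) : (empiricalTheta X n ω).1 p =
    (n : ℝ)⁻¹ * ∑ m ∈ Finset.range n, if (X m ω, X (m + 1) ω) = p then (1 : ℝ) else 0 := by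
  simp only [empiricalTheta]
  rw [sum_Icc_one_eq_sum_range]
  simp

/-- Interchanging the sums over transitions and times turns a linear functional into an additive
functional of the trajectory, since each step uses exactly one pair. -/
lemma mul_sum_dotProduct_empirical (lam : 𝒳 × 𝒳 → Fin d → ℝ) (c : 𝒳 × 𝒳 → ℝ) (n : ℕ+) (ω : Ω) :
    (n : ℝ) * ∑ p, (lam p ⬝ᵥ empiricalK X A n ω p + (empiricalTheta X n ω).1 p * c p) =
      ∑ m ∈ Finset.range n, (lam (X m ω, X (m + 1) ω) ⬝ᵥ A (m + 1) ω +
        c (X m ω, X (m + 1) ω)) := by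
  have hn : (n : ℝ) ≠ 0 := by exact_mod_cast n.ne_zero
  have h : ∀ p, (n : ℝ) * (lam p ⬝ᵥ empiricalK X A n ω p + (empiricalTheta X n ω).1 p * c p) =
      ∑ m ∈ Finset.range n,
        if (X m ω, X (m + 1) ω) = p then lam p ⬝ᵥ A (m + 1) ω + c p else 0 := fun p => by
    rw [empiricalK_eq, empiricalTheta_eq, dotProduct_smul, smul_eq_mul, mul_assoc, ← mul_add,
      mul_inv_cancel_left₀ hn, dotProduct_sum, Finset.sum_mul, ← Finset.sum_add_distrib]
    refine Finset.sum_congr rfl fun m _ => ?_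
    split_ifs <;> simp
  rw [Finset.mul_sum]
  simp only [h]
  rw [Finset.sum_comm]
  refine Finset.sum_congr rfl fun m _ => ?_
  rw [Finset.sum_ite_eq]
  simp

/-- The `ℓ¹`-norm of the first component. -/
def normFst (z : (𝒳 × 𝒳 → Fin d → ℝ) × stdSimplex ℝ (𝒳 × 𝒳)) : ℝ := ∑ p, ∑ i, |z.1 p i|

lemma mul_normFst_empirical_le (n : ℕ+) (ω : Ω) :
    (n : ℝ) * normFst (empiricalK X A n ω, empiricalTheta X n ω) ≤
      ∑ m ∈ Finset.range n, ∑ i, |A (m + 1) ω i| := by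
  have hn : (0 : ℝ) < n := by exact_mod_cast n.pos
  have h : ∀ p, (n : ℝ) * ∑ i, |empiricalK X A n ω p i| ≤
      ∑ m ∈ Finset.range n,
        if (X m ω, X (m + 1) ω) = p then ∑ i, |A (m + 1) ω i| else 0 := fun p => by
    have hi : ∀ i, (n : ℝ) * |empiricalK X A n ω p i| ≤
        ∑ m ∈ Finset.range n, if (X m ω, X (m + 1) ω) = p then |A (m + 1) ω i| else 0 :=
      fun i => by
        rw [empiricalK_eq, Pi.smul_apply, smul_eq_mul, abs_mul, abs_of_pos (inv_pos.2 hn),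
          mul_inv_cancel_left₀ hn.ne', Finset.sum_apply]
        refine (Finset.abs_sum_le_sum_abs _ _).trans (le_of_eq ?_)
        refine Finset.sum_congr rfl fun m _ => ?_
        split_ifs <;> simp
    rw [Finset.mul_sum]
    refine (Finset.sum_le_sum fun i _ => hi i).trans (le_of_eq ?_)
    rw [Finset.sum_comm]
    refine Finset.sum_congr rfl fun m _ => ?_
    split_ifs <;> simp
  rw [normFst, Finset.mul_sum]
  refine (Finset.sum_le_sum fun p _ => h p).trans (le_of_eq ?_)
  rw [Finset.sum_comm]
  refine Finset.sum_congr rfl fun m _ => ?_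
  rw [Finset.sum_ite_eq]
  simp

omit [DecidableEq 𝒳] in
lemma continuous_normFst :
    Continuous (normFst : (𝒳 × 𝒳 → Fin d → ℝ) × stdSimplex ℝ (𝒳 × 𝒳) → ℝ) := by
  unfold normFst
  exact continuous_finsetSum _ fun p _ => continuous_finsetSum _ fun i _ => by fun_prop

omit [DecidableEq 𝒳] in
lemma isCompact_normFst_le (M : ℝ) :
    IsCompact {z : (𝒳 × 𝒳 → Fin d → ℝ) × stdSimplex ℝ (𝒳 × 𝒳) | normFst z ≤ M} := by
  refine ((isCompact_closedBall (0 : 𝒳 × 𝒳 → Fin d → ℝ) M).prod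
    (isCompact_univ (X := stdSimplex ℝ (𝒳 × 𝒳)))).of_isClosed_subset
    (isClosed_le continuous_normFst continuous_const) fun z hz => ⟨?_, Set.mem_univ _⟩
  have hz' : normFst z ≤ M := hz
  have h0 : ∀ p, 0 ≤ ∑ i, |z.1 p i| := fun p => Finset.sum_nonneg fun _ _ => abs_nonneg _
  have hM : 0 ≤ M := (Finset.sum_nonneg fun p _ => h0 p).trans hz'
  rw [mem_closedBall_zero_iff, pi_norm_le_iff_of_nonneg hM]
  intro p
  rw [pi_norm_le_iff_of_nonneg hM]
  intro i
  calc ‖z.1 p i‖ ≤ ∑ i, |z.1 p i| :=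
        Finset.single_le_sum (f := fun i => |z.1 p i|) (fun _ _ => abs_nonneg _) (Finset.mem_univ i)
    _ ≤ normFst z := Finset.single_le_sum (f := fun p => ∑ i, |z.1 p i|) (fun p _ => h0 p)
        (Finset.mem_univ p)
    _ ≤ M := hz'

omit [DecidableEq 𝒳] in
lemma continuous_tilt {q : 𝒳 → 𝒳 → Measure (Fin d → ℝ)} (lam : 𝒳 × 𝒳 → Fin d → ℝ)
    (g : 𝒳 × 𝒳 → ℝ) (u : 𝒳 → ℝ) : Continuous (tilt q lam g u) := by
  unfold tilt
  simp only [dotProduct]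
  refine continuous_finsetSum _ fun p _ => Continuous.add
    (continuous_finsetSum _ fun i _ => by fun_prop) (Continuous.mul ?_ continuous_const)
  exact (continuous_apply p).comp (continuous_subtype_val.comp continuous_snd)

omit [DecidableEq 𝒳] in
lemma theta_le_one (θ : stdSimplex ℝ (𝒳 × 𝒳)) (p : 𝒳 × 𝒳) : θ.1 p ≤ 1 := by
  rw [← θ.2.2]
  exact Finset.single_le_sum (fun p _ => θ.2.1 p) (Finset.mem_univ p)

omit [DecidableEq 𝒳] in
lemma tilt_le_add_mul_normFst {q : 𝒳 → 𝒳 → Measure (Fin d → ℝ)} (lam : 𝒳 × 𝒳 → Fin d → ℝ)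
    (g : 𝒳 × 𝒳 → ℝ) (u : 𝒳 → ℝ) : ∃ s, ∀ z, tilt q lam g u z ≤ s + s * normFst z := by
  set c : 𝒳 × 𝒳 → ℝ := fun p => g p - cumulant (q p.1 p.2) (lam p) + (u p.1 - u p.2) with hc
  set s : ℝ := ∑ p, (|c p| + ∑ i, |lam p i|) with hs
  have hc0 : ∀ p, 0 ≤ |c p| + ∑ i, |lam p i| := fun p =>
    add_nonneg (abs_nonneg _) (Finset.sum_nonneg fun _ _ => abs_nonneg _)
  refine ⟨s, fun z => ?_⟩
  rw [tilt, Finset.sum_add_distrib, add_comm]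
  refine add_le_add ?_ ?_
  · refine Finset.sum_le_sum fun p _ => ?_
    calc z.2.1 p * c p ≤ z.2.1 p * |c p| :=
          mul_le_mul_of_nonneg_left (le_abs_self _) (z.2.2.1 p)
      _ ≤ |c p| := mul_le_of_le_one_left (abs_nonneg _) (theta_le_one _ _)
      _ ≤ _ := le_add_of_nonneg_right (Finset.sum_nonneg fun _ _ => abs_nonneg _)
  · rw [normFst, Finset.mul_sum]
    refine Finset.sum_le_sum fun p _ => dotProduct_le_mul_sum_abs (fun i => ?_) _
    calc |lam p i| ≤ ∑ i, |lam p i| := Finset.single_le_sum (f := fun i => |lam p i|)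
          (fun _ _ => abs_nonneg _) (Finset.mem_univ i)
      _ ≤ |c p| + ∑ i, |lam p i| := le_add_of_nonneg_left (abs_nonneg _)
      _ ≤ s := Finset.single_le_sum (f := fun p => |c p| + ∑ i, |lam p i|) (fun p _ => hc0 p)
        (Finset.mem_univ p)

-- Coercivity, which yields compact sublevel sets. Taking for `lam` the signs of `k` gives the
-- `ℓ¹`-norm, and the cumulants at sign vectors are bounded by the exponential moment of order `1`.
omit [DecidableEq 𝒳] in
lemma exists_normFst_sub_le_tilt {P : Matrix 𝒳 𝒳 ℝ} {q : 𝒳 → 𝒳 → Measure (Fin d → ℝ)}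
    [∀ x y, IsProbabilityMeasure (q x y)] (hP1 : ∀ x, ∑ y, P x y = 1)
    (hq : ∀ x y, HasExpMoments (q x y)) :
    ∃ C : ℝ, ∀ z, ∃ f ∈ tilts P q, normFst z - C ≤ f z := by
  set κ : 𝒳 × 𝒳 → ℝ := fun p => Real.log (∫ a, Real.exp (1 * ∑ i, |a i|) ∂(q p.1 p.2)) with hκ
  refine ⟨∑ p, |κ p|, fun z => ?_⟩
  set lam : 𝒳 × 𝒳 → Fin d → ℝ := fun p i => if 0 ≤ z.1 p i then 1 else -1 with hlam
  refine ⟨_, ⟨lam, 0, 0, isSubdensity_zero hP1, rfl⟩, ?_⟩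
  have hdot : ∀ p, lam p ⬝ᵥ z.1 p = ∑ i, |z.1 p i| := fun p => by
    refine Finset.sum_congr rfl fun i _ => ?_
    simp only [hlam]
    split_ifs with h
    · rw [one_mul, abs_of_nonneg h]
    · rw [neg_one_mul, abs_of_neg (not_le.1 h)]
  have hcum : ∀ p, cumulant (q p.1 p.2) (lam p) ≤ κ p := fun p => by
    refine Real.log_le_log ((hq _ _).integral_exp_pos _) ?_
    refine integral_mono ((hq _ _).integrable_exp_dotProduct _) (hq _ _ 1) fun a => ?_
    refine Real.exp_le_exp.2 (dotProduct_le_mul_sum_abs (fun i => ?_) a)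
    simp only [hlam]
    split_ifs <;> simp
  rw [tilt_eq, Finset.sum_sub_distrib]
  simp only [hdot, Pi.zero_apply, mul_zero, zero_mul, Finset.sum_const_zero, add_zero]
  have : ∑ p, z.2.1 p * cumulant (q p.1 p.2) (lam p) ≤ ∑ p, |κ p| := by
    refine Finset.sum_le_sum fun p _ => ?_
    calc z.2.1 p * cumulant (q p.1 p.2) (lam p) ≤ z.2.1 p * |κ p| :=
          mul_le_mul_of_nonneg_left ((hcum p).trans (le_abs_self _)) (z.2.2.1 p)
      _ ≤ |κ p| := mul_le_of_le_one_left (abs_nonneg _) (theta_le_one _ _)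
  exact sub_le_sub_left this _

variable [MeasurableSpace Ω] {μ : Measure Ω} [IsProbabilityMeasure μ]
  [MeasurableSpace 𝒳] [MeasurableSingletonClass 𝒳]

lemma measurable_empirical (hX : ∀ m, Measurable (X m)) (hA : ∀ m, 1 ≤ m → Measurable (A m))
    (n : ℕ+) : Measurable fun ω => (empiricalK X A n ω, empiricalTheta X n ω) := by
  have hset : ∀ (m : ℕ) (p : 𝒳 × 𝒳), MeasurableSet {ω | (X m ω, X (m + 1) ω) = p} :=
    fun m p => ((hX m).prodMk (hX (m + 1))) (measurableSet_singleton p)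
  refine Measurable.prodMk ?_ ?_
  · refine measurable_pi_lambda _ fun p => ?_
    simp only [empiricalK_eq]
    have : Measurable fun ω => ∑ m ∈ Finset.range n,
        if (X m ω, X (m + 1) ω) = p then A (m + 1) ω else 0 :=
      Finset.measurable_sum _ fun m _ =>
        Measurable.ite (hset m p) (hA _ (by lia)) measurable_const
    exact this.const_smul (n : ℝ)⁻¹
  · refine Measurable.subtype_mk (measurable_pi_lambda _ fun p => ?_)
    have := fun ω => empiricalTheta_eq (X := X) n ω p
    simp only [empiricalTheta] at this
    simp only [this]
    refine Measurable.const_mul (Finset.measurable_sum _ fun m _ => ?_) _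
    exact Measurable.ite (hset m p) measurable_const measurable_const

variable {P : Matrix 𝒳 𝒳 ℝ} {q : 𝒳 → 𝒳 → Measure (Fin d → ℝ)}
  [hqp : ∀ x y, IsProbabilityMeasure (q x y)]

/-- The multiplicative increment of the exponential martingale attached to `lam` and `g`. -/
noncomputable def expIncrement (q : 𝒳 → 𝒳 → Measure (Fin d → ℝ)) (lam : 𝒳 × 𝒳 → Fin d → ℝ)
    (g : 𝒳 × 𝒳 → ℝ) (x y : 𝒳) (a : Fin d → ℝ) : ℝ≥0∞ :=
  ENNReal.ofReal (Real.exp (lam (x, y) ⬝ᵥ a + (g (x, y) - cumulant (q x y) (lam (x, y)))))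

omit [DecidableEq 𝒳] [Fintype 𝒳] [MeasurableSpace 𝒳] [MeasurableSingletonClass 𝒳] hqp in
lemma measurable_expIncrement (lam : 𝒳 × 𝒳 → Fin d → ℝ) (g : 𝒳 × 𝒳 → ℝ) (x y : 𝒳) :
    Measurable (expIncrement q lam g x y) :=
  ((measurable_dotProduct _).add_const _).exp.ennreal_ofReal

-- Subtracting the cumulant normalises the integral over `q x y`, leaving only the row sum of the
-- density: at most `1` gives a supermartingale, at least `1` a submartingale.
omit [DecidableEq 𝒳] [MeasurableSpace 𝒳] [MeasurableSingletonClass 𝒳] in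
lemma sum_mul_lintegral_expIncrement (hP0 : ∀ x y, 0 ≤ P x y)
    (hq : ∀ x y, HasExpMoments (q x y)) (lam : 𝒳 × 𝒳 → Fin d → ℝ) (g : 𝒳 × 𝒳 → ℝ) (x : 𝒳) :
    ∑ y, ENNReal.ofReal (P x y) * ∫⁻ a, expIncrement q lam g x y a ∂(q x y) =
      ENNReal.ofReal (∑ y, P x y * Real.exp (g (x, y))) := by
  rw [ENNReal.ofReal_sum_of_nonneg fun y _ => mul_nonneg (hP0 x y) (Real.exp_pos _).le]
  refine Finset.sum_congr rfl fun y _ => ?_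
  rw [ENNReal.ofReal_mul (hP0 x y)]
  congr 1
  simp only [expIncrement, Real.exp_add]
  simp only [ENNReal.ofReal_mul (Real.exp_pos _).le]
  rw [lintegral_mul_const' _ _ ENNReal.ofReal_ne_top, (hq x y).lintegral_exp,
    ← ENNReal.ofReal_mul (Real.exp_pos _).le, ← Real.exp_add, add_sub_cancel]

-- The multiplier telescopes to a boundary term bounded uniformly in `n`, which is why it is free at
-- exponential scale.
omit [MeasurableSpace Ω] [MeasurableSpace 𝒳] [MeasurableSingletonClass 𝒳] hqp in
lemma exp_mul_tilt_empirical (lam : 𝒳 × 𝒳 → Fin d → ℝ) (g : 𝒳 × 𝒳 → ℝ) (u : 𝒳 → ℝ)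
    (n : ℕ+) (ω : Ω) :
    ENNReal.ofReal (Real.exp (n * tilt q lam g u (empiricalK X A n ω, empiricalTheta X n ω))) =
      ENNReal.ofReal (Real.exp (u (X 0 ω) - u (X n ω))) *
        ∏ m ∈ Finset.range n, expIncrement q lam g (X m ω) (X (m + 1) ω) (A (m + 1) ω) := by
  have htel : ∑ m ∈ Finset.range n, (u (X m ω) - u (X (m + 1) ω)) = u (X 0 ω) - u (X n ω) :=
    Finset.sum_range_sub' (fun m => u (X m ω)) n
  simp only [expIncrement]
  rw [← ENNReal.ofReal_prod_of_nonneg fun _ _ => (Real.exp_pos _).le, ← Real.exp_sum,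
    ← ENNReal.ofReal_mul (Real.exp_pos _).le, ← Real.exp_add, tilt,
    mul_sum_dotProduct_empirical, ← htel, ← Finset.sum_add_distrib]
  congr 2
  exact Finset.sum_congr rfl fun m _ => by ring

lemma exists_lintegral_exp_tilt_le (hX : ∀ m, Measurable (X m))
    (hA : ∀ m, 1 ≤ m → Measurable (A m)) (hM : IsMarkovChain μ P X)
    (hIndep : CondIndepOnTransitions μ X A q) (hP0 : ∀ x y, 0 ≤ P x y)
    (hq : ∀ x y, HasExpMoments (q x y)) {f} (hf : f ∈ tilts P q) :
    ∃ C : ℝ, ∀ n : ℕ+, ∫⁻ ω, ENNReal.ofReal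
      (Real.exp (n * f (empiricalK X A n ω, empiricalTheta X n ω))) ∂μ ≤ ENNReal.ofReal C := by
  obtain ⟨lam, g, u, hg, rfl⟩ := hf
  refine ⟨Real.exp (2 * ∑ x, |u x|), fun n => ?_⟩
  have hu : ∀ x, |u x| ≤ ∑ x, |u x| := fun x =>
    Finset.single_le_sum (f := fun x => |u x|) (fun _ _ => abs_nonneg _) (Finset.mem_univ x)
  calc _ ≤ ∫⁻ ω, ENNReal.ofReal (Real.exp (2 * ∑ x, |u x|)) *
        ∏ m ∈ Finset.range n, expIncrement q lam g (X m ω) (X (m + 1) ω) (A (m + 1) ω) ∂μ := by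
        refine lintegral_mono fun ω => ?_
        rw [exp_mul_tilt_empirical]
        gcongr
        have h1 := (abs_le.1 ((hu (X 0 ω)))).2
        have h2 := (abs_le.1 ((hu (X n ω)))).1
        linarith
    _ ≤ ENNReal.ofReal (Real.exp (2 * ∑ x, |u x|)) * 1 ^ (n : ℕ) := by
        rw [lintegral_const_mul' _ _ ENNReal.ofReal_ne_top]
        gcongr
        refine lintegral_prod_le_pow hX hA hM hqp hIndep _
          (measurable_expIncrement lam g) 1 (fun x => ?_) n
        rw [sum_mul_lintegral_expIncrement hP0 hq]
        exact ENNReal.ofReal_le_one.2 (hg x)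
    _ = _ := by simp

lemma one_le_lintegral_exp_tilt (hX : ∀ m, Measurable (X m))
    (hA : ∀ m, 1 ≤ m → Measurable (A m)) (hM : IsMarkovChain μ P X)
    (hIndep : CondIndepOnTransitions μ X A q) (hP0 : ∀ x y, 0 ≤ P x y)
    (hq : ∀ x y, HasExpMoments (q x y)) (lam : 𝒳 × 𝒳 → Fin d → ℝ) (g : 𝒳 × 𝒳 → ℝ)
    (hg : ∀ x, 1 ≤ ∑ y, P x y * Real.exp (g (x, y))) (n : ℕ+) :
    1 ≤ ∫⁻ ω, ENNReal.ofReal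
      (Real.exp (n * tilt q lam g 0 (empiricalK X A n ω, empiricalTheta X n ω))) ∂μ := by
  simp only [exp_mul_tilt_empirical, Pi.zero_apply, sub_self, Real.exp_zero, ENNReal.ofReal_one,
    one_mul]
  refine one_le_lintegral_prod hX hA hM hqp hIndep _ (measurable_expIncrement lam g)
    (fun x => ?_) n
  rw [sum_mul_lintegral_expIncrement hP0 hq]
  exact ENNReal.one_le_ofReal.2 (hg x)

lemma exists_lintegral_exp_normFst_le (hX : ∀ m, Measurable (X m))
    (hA : ∀ m, 1 ≤ m → Measurable (A m)) (hM : IsMarkovChain μ P X)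
    (hIndep : CondIndepOnTransitions μ X A q)
    (hq : ∀ x y, HasExpMoments (q x y)) (s : ℝ) :
    ∃ C : ℝ, ∀ n : ℕ+, ∫⁻ ω, ENNReal.ofReal
      (Real.exp (n * (s * normFst (empiricalK X A n ω, empiricalTheta X n ω)))) ∂μ ≤
        ENNReal.ofReal (Real.exp (n * C)) := by
  set F : 𝒳 → 𝒳 → (Fin d → ℝ) → ℝ≥0∞ :=
    fun _ _ a => ENNReal.ofReal (Real.exp (|s| * ∑ i, |a i|)) with hF
  have hFm : ∀ x y, Measurable (F x y) := fun x y => by fun_prop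
  -- A crude bound on every one-step factor, valid for all starting states; `D ≤ exp D` then puts it
  -- in exponential form.
  set D : ℝ≥0∞ := ∑ x, ∑ y, ENNReal.ofReal (P x y) * ∫⁻ a, F x y a ∂(q x y) with hD
  have hDtop : D ≠ ⊤ := by
    refine ENNReal.sum_ne_top.2 fun x _ => ENNReal.sum_ne_top.2 fun y _ =>
      ENNReal.mul_ne_top ENNReal.ofReal_ne_top ?_
    exact (hq x y |s|).lintegral_lt_top.ne
  refine ⟨D.toReal, fun n => ?_⟩
  have hn : (0 : ℝ) < n := by exact_mod_cast n.pos
  calc _ ≤ ∫⁻ ω, ∏ m ∈ Finset.range n, F (X m ω) (X (m + 1) ω) (A (m + 1) ω) ∂μ := by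
        refine lintegral_mono fun ω => ?_
        simp only [hF]
        rw [← ENNReal.ofReal_prod_of_nonneg fun _ _ => (Real.exp_pos _).le, ← Real.exp_sum,
          ← Finset.mul_sum]
        apply ENNReal.ofReal_le_ofReal
        apply Real.exp_le_exp.2
        have h0 : 0 ≤ normFst (empiricalK X A n ω, empiricalTheta X n ω) :=
          Finset.sum_nonneg fun _ _ => Finset.sum_nonneg fun _ _ => abs_nonneg _
        calc (n : ℝ) * (s * normFst (empiricalK X A n ω, empiricalTheta X n ω))
            ≤ n * (|s| * normFst (empiricalK X A n ω, empiricalTheta X n ω)) := by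
              gcongr
              exact le_abs_self s
          _ = |s| * (n * normFst (empiricalK X A n ω, empiricalTheta X n ω)) := by ring
          _ ≤ _ := by
              gcongr
              exact mul_normFst_empirical_le n ω
    _ ≤ D ^ (n : ℕ) := by
        refine lintegral_prod_le_pow hX hA hM hqp hIndep F hFm D (fun x => ?_) n
        exact Finset.single_le_sum
          (f := fun x => ∑ y, ENNReal.ofReal (P x y) * ∫⁻ a, F x y a ∂(q x y))
          (fun _ _ => zero_le) (Finset.mem_univ x)
    _ ≤ ENNReal.ofReal (Real.exp D.toReal) ^ (n : ℕ) := by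
        gcongr
        rw [← ENNReal.ofReal_toReal hDtop, ENNReal.toReal_ofReal ENNReal.toReal_nonneg]
        apply ENNReal.ofReal_le_ofReal
        linarith [Real.add_one_le_exp D.toReal]
    _ = _ := by
        rw [← ENNReal.ofReal_pow (Real.exp_pos _).le, ← Real.exp_nat_mul]

end EmpiricalBounds

/-! ### Balanced pair distributions of an irreducible matrix. -/

section Circulation

variable {𝒳 : Type*} [Fintype 𝒳] {P : Matrix 𝒳 𝒳 ℝ}

omit [Fintype 𝒳] in
lemma reflTransGen_of_isIrreducible (hP : P.IsIrreducible) (x y : 𝒳) :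
    Relation.ReflTransGen (fun x y => 0 < P x y) x y := by
  let : Quiver 𝒳 := Matrix.toQuiver P
  obtain ⟨p, -⟩ := hP.connected x y
  induction p with
  | nil => exact .refl
  | cons _ e ih => exact ih.tail e.down

lemma marginalFst_add (θ η : 𝒳 × 𝒳 → ℝ) (x : 𝒳) :
    marginalFst (θ + η) x = marginalFst θ x + marginalFst η x := by
  simp [marginalFst, Finset.sum_add_distrib]

lemma marginalSnd_add (θ η : 𝒳 × 𝒳 → ℝ) (x : 𝒳) :
    marginalSnd (θ + η) x = marginalSnd θ x + marginalSnd η x := by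
  simp [marginalSnd, Finset.sum_add_distrib]

lemma marginalFst_smul (t : ℝ) (θ : 𝒳 × 𝒳 → ℝ) (x : 𝒳) :
    marginalFst (t • θ) x = t * marginalFst θ x := by
  simp [marginalFst, Finset.mul_sum]

lemma marginalSnd_smul (t : ℝ) (θ : 𝒳 × 𝒳 → ℝ) (x : 𝒳) :
    marginalSnd (t • θ) x = t * marginalSnd θ x := by
  simp [marginalSnd, Finset.mul_sum]

lemma marginalFst_sum {ι : Type*} (s : Finset ι) (θ : ι → 𝒳 × 𝒳 → ℝ) (x : 𝒳) :
    marginalFst (∑ i ∈ s, θ i) x = ∑ i ∈ s, marginalFst (θ i) x := by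
  simp only [marginalFst, Finset.sum_apply]
  exact Finset.sum_comm

lemma marginalSnd_sum {ι : Type*} (s : Finset ι) (θ : ι → 𝒳 × 𝒳 → ℝ) (x : 𝒳) :
    marginalSnd (∑ i ∈ s, θ i) x = ∑ i ∈ s, marginalSnd (θ i) x := by
  simp only [marginalSnd, Finset.sum_apply]
  exact Finset.sum_comm

lemma marginalFst_single [DecidableEq 𝒳] (a b v : 𝒳) :
    marginalFst (Pi.single (a, b) 1) v = if v = a then 1 else 0 := by
  simp only [marginalFst, Pi.single_apply, Prod.mk.injEq]
  by_cases h : v = a <;> simp [h]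

lemma marginalSnd_single [DecidableEq 𝒳] (a b v : 𝒳) :
    marginalSnd (Pi.single (a, b) 1) v = if v = b then 1 else 0 := by
  simp only [marginalSnd, Pi.single_apply, Prod.mk.injEq]
  by_cases h : v = b <;> simp [h]

/-- Edge counts of a path from `x` to `y`. -/
lemma exists_flow_of_reflTransGen [DecidableEq 𝒳] {x y : 𝒳}
    (h : Relation.ReflTransGen (fun x y => 0 < P x y) x y) :
    ∃ N : 𝒳 × 𝒳 → ℝ, (∀ p, 0 ≤ N p) ∧ (∀ p : 𝒳 × 𝒳, P p.1 p.2 = 0 → N p = 0) ∧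
      ∀ v, marginalFst N v - marginalSnd N v =
        (if v = x then 1 else 0) - (if v = y then 1 else 0) := by
  induction h with
  | refl => exact ⟨0, by simp, by simp, by simp [marginalFst, marginalSnd]⟩
  | @tail b c _ hbc ih =>
    obtain ⟨N, h0, hs, hN⟩ := ih
    refine ⟨N + Pi.single (b, c) 1, fun p => ?_, fun p hp => ?_, fun v => ?_⟩
    · refine add_nonneg (h0 p) ?_
      rw [Pi.single_apply]
      split_ifs <;> norm_num
    · rw [Pi.add_apply, hs p hp, Pi.single_apply, if_neg, add_zero]
      rintro rfl
      exact hbc.ne' hp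
    · rw [marginalFst_add, marginalSnd_add, marginalFst_single, marginalSnd_single]
      linarith [hN v]

/-- An irreducible matrix carries a balanced pair distribution charging exactly its support. -/
lemma exists_positive_circulation [Nonempty 𝒳] (hP : P.IsIrreducible)
    (hP1 : ∀ x, ∑ y, P x y = 1) :
    ∃ θ : stdSimplex ℝ (𝒳 × 𝒳), (∀ p : 𝒳 × 𝒳, 0 < P p.1 p.2 → 0 < θ.1 p) ∧
      (∀ p : 𝒳 × 𝒳, P p.1 p.2 = 0 → θ.1 p = 0) ∧ marginalFst θ.1 = marginalSnd θ.1 := by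
  classical
  -- Closing the edge `e` by a path from its head back to its tail gives a balanced flow that
  -- charges `e`; summing over all edges charges the whole support.
  have hcycle : ∀ e : 𝒳 × 𝒳, ∃ N : 𝒳 × 𝒳 → ℝ, (∀ p, 0 ≤ N p) ∧
      (∀ p : 𝒳 × 𝒳, P p.1 p.2 = 0 → N p = 0) ∧ (0 < P e.1 e.2 → 0 < N e) ∧
      ∀ v, marginalFst N v = marginalSnd N v := by
    intro e
    by_cases he : 0 < P e.1 e.2
    swap
    · exact ⟨0, by simp, by simp, fun h => absurd h he, by simp [marginalFst, marginalSnd]⟩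
    obtain ⟨N, h0, hs, hN⟩ := exists_flow_of_reflTransGen (reflTransGen_of_isIrreducible hP e.2 e.1)
    have h1 : ∀ p, (0 : ℝ) ≤ (Pi.single e 1 : 𝒳 × 𝒳 → ℝ) p := fun p => by
      rw [Pi.single_apply]
      split_ifs <;> norm_num
    refine ⟨N + Pi.single e 1, fun p => add_nonneg (h0 p) (h1 p), fun p hp => ?_, fun _ => ?_,
      fun v => ?_⟩
    · rw [Pi.add_apply, hs p hp, Pi.single_apply, if_neg, add_zero]
      rintro rfl
      exact he.ne' hp
    · rw [Pi.add_apply, Pi.single_eq_same]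
      linarith [h0 e]
    · rw [marginalFst_add, marginalSnd_add, marginalFst_single, marginalSnd_single]
      linarith [hN v]
  choose N hN0 hNs hNp hNm using hcycle
  set η : 𝒳 × 𝒳 → ℝ := ∑ e, N e with hη
  have hη0 : ∀ p, 0 ≤ η p := fun p => by
    rw [hη, Finset.sum_apply]
    exact Finset.sum_nonneg fun e _ => hN0 e p
  have hηp : ∀ p : 𝒳 × 𝒳, 0 < P p.1 p.2 → 0 < η p := fun p hp => by
    rw [hη, Finset.sum_apply]
    exact (hNp p hp).trans_le (Finset.single_le_sum (f := fun e => N e p) (fun e _ => hN0 e p)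
      (Finset.mem_univ p))
  have hT : 0 < ∑ p, η p := by
    obtain ⟨x⟩ := ‹Nonempty 𝒳›
    obtain ⟨y, hy⟩ : ∃ y, 0 < P x y := by
      by_contra! hcon
      have := Finset.sum_nonpos fun y (_ : y ∈ Finset.univ) => hcon y
      rw [hP1] at this
      linarith
    exact (hηp (x, y) hy).trans_le (Finset.single_le_sum (fun p _ => hη0 p) (Finset.mem_univ _))
  refine ⟨⟨(∑ p, η p)⁻¹ • η, fun p => ?_, ?_⟩, fun p hp => ?_, fun p hp => ?_, ?_⟩
  · exact mul_nonneg (inv_pos.2 hT).le (hη0 p)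
  · simp only [Pi.smul_apply, smul_eq_mul]
    rw [← Finset.mul_sum, inv_mul_cancel₀ hT.ne']
  · exact mul_pos (inv_pos.2 hT) (hηp p hp)
  · have : η p = 0 := by
      rw [hη, Finset.sum_apply]
      exact Finset.sum_eq_zero fun e _ => hNs e p hp
    simp [this]
  · funext v
    simp only [marginalFst_smul, marginalSnd_smul]
    rw [hη, marginalFst_sum, marginalSnd_sum]
    simp only [hNm]

/-- Uniqueness of the balanced pair distribution with given irreducible transition kernel. -/
lemma eq_of_same_kernel (hP : P.IsIrreducible) {θ η : 𝒳 × 𝒳 → ℝ}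
    (hθ0 : ∀ p, 0 ≤ θ p) (hθP : ∀ p : 𝒳 × 𝒳, 0 < P p.1 p.2 → 0 < θ p)
    (hθm : marginalFst θ = marginalSnd θ) (hθ1 : ∑ p, θ p = 1)
    (hηm : marginalFst η = marginalSnd η) (hη1 : ∑ p, η p = 1)
    (hker : ∀ p, η p = marginalFst η p.1 * (θ p / marginalFst θ p.1)) : η = θ := by
  set a : 𝒳 → ℝ := fun x => marginalFst η x / marginalFst θ x with ha
  have hηa : ∀ p, η p = a p.1 * θ p := fun p => by
    rw [hker p, ha]
    ring
  have hne : Nonempty 𝒳 := by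
    by_contra hcon
    rw [not_nonempty_iff] at hcon
    simp at hθ1
  obtain ⟨x₀, hx₀⟩ := Finite.exists_min a
  -- The ratio of marginals is harmonic for the reversed kernel. At a minimum every term is
  -- nonnegative, so all predecessors are minima too; irreducibility spreads this to every state.
  have hbal : ∀ y, ∑ x, (a x - a y) * θ (x, y) = 0 := fun y => by
    have h1 : ∑ x, a x * θ (x, y) = a y * marginalFst θ y := by
      have h2 := (congrFun hηm y).symm
      rw [marginalSnd] at h2
      simp only [hηa] at h2
      rw [h2, marginalFst, marginalFst, Finset.mul_sum]
      exact Finset.sum_congr rfl fun z _ => hηa (y, z)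
    simp only [sub_mul]
    rw [Finset.sum_sub_distrib, h1, hθm, marginalSnd, Finset.mul_sum, sub_self]
  have hconst : ∀ x, a x = a x₀ := fun x => by
    induction reflTransGen_of_isIrreducible hP x x₀ using Relation.ReflTransGen.head_induction_on with
    | refl => rfl
    | @head b c hbc _ ih =>
      have h1 := hbal c
      rw [Finset.sum_eq_zero_iff_of_nonneg] at h1
      · have h2 := h1 b (Finset.mem_univ b)
        rcases mul_eq_zero.1 h2 with h3 | h3
        · linarith
        · exact absurd h3 (hθP (b, c) hbc).ne'
      · intro z _
        refine mul_nonneg ?_ (hθ0 _)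
        rw [ih]
        linarith [hx₀ z]
  have h1 : a x₀ = 1 := by
    simp only [hηa, hconst] at hη1
    rwa [← Finset.mul_sum, hθ1, mul_one] at hη1
  funext p
  rw [hηa, hconst, h1, one_mul]

end Circulation

/-! ### Exposed points of the rate functional. -/

section Exposed

variable {𝒳 : Type*} [Fintype 𝒳] {d : ℕ}
  {P : Matrix 𝒳 𝒳 ℝ} {q : 𝒳 → 𝒳 → Measure (Fin d → ℝ)} [∀ x y, IsProbabilityMeasure (q x y)]

/-- The logarithm of the density of the kernel of `θ` with respect to `P`. -/
noncomputable def logKernelDensity (P : Matrix 𝒳 𝒳 ℝ) (θ : 𝒳 × 𝒳 → ℝ) (p : 𝒳 × 𝒳) : ℝ :=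
  Real.log (θ p / (marginalFst θ p.1 * P p.1 p.2))

variable (hP0 : ∀ x y, 0 ≤ P x y) (hP1 : ∀ x, ∑ y, P x y = 1)

include hP1 in
lemma marginalFst_pos {θ : 𝒳 × 𝒳 → ℝ} (hθ0 : ∀ p, 0 ≤ θ p)
    (hθP : ∀ p : 𝒳 × 𝒳, 0 < P p.1 p.2 → 0 < θ p) (x : 𝒳) : 0 < marginalFst θ x := by
  obtain ⟨y, hy⟩ : ∃ y, 0 < P x y := by
    by_contra! hcon
    have := Finset.sum_nonpos fun y (_ : y ∈ Finset.univ) => hcon y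
    rw [hP1] at this
    linarith
  exact (hθP (x, y) hy).trans_le (le_marginalFst hθ0 x y)

include hP0 hP1 in
lemma sum_mul_exp_logKernelDensity {θ : 𝒳 × 𝒳 → ℝ} (hθ0 : ∀ p, 0 ≤ θ p)
    (hθP : ∀ p : 𝒳 × 𝒳, 0 < P p.1 p.2 → 0 < θ p)
    (hθs : ∀ p : 𝒳 × 𝒳, P p.1 p.2 = 0 → θ p = 0) (x : 𝒳) :
    ∑ y, P x y * Real.exp (logKernelDensity P θ (x, y)) = 1 := by
  have hm := marginalFst_pos hP1 hθ0 hθP x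
  have : ∀ y, P x y * Real.exp (logKernelDensity P θ (x, y)) = θ (x, y) / marginalFst θ x :=
    fun y => by
    rcases (hP0 x y).eq_or_lt with h | h
    · rw [hθs (x, y) h.symm, ← h]
      simp
    · rw [logKernelDensity, Real.exp_log (div_pos (hθP (x, y) h) (mul_pos hm h))]
      field_simp
  simp only [this]
  rw [← Finset.sum_div]
  exact div_self hm.ne'

-- Strict concavity of the logarithm: testing maximality against the average of the kernels of `θ`
-- and `η` gains a sum of squares of their difference, which must vanish.
include hP0 hP1 in
lemma kernel_eq_of_sum_le {θ η : 𝒳 × 𝒳 → ℝ} (hθ0 : ∀ p, 0 ≤ θ p)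
    (hθP : ∀ p : 𝒳 × 𝒳, 0 < P p.1 p.2 → 0 < θ p)
    (hθs : ∀ p : 𝒳 × 𝒳, P p.1 p.2 = 0 → θ p = 0) (hη0 : ∀ p, 0 ≤ η p)
    (hηs : ∀ p : 𝒳 × 𝒳, P p.1 p.2 = 0 → η p = 0)
    (hmax : ∀ g, IsSubdensity P g → ∑ p, η p * g p ≤ ∑ p, η p * logKernelDensity P θ p)
    (p : 𝒳 × 𝒳) : η p = marginalFst η p.1 * (θ p / marginalFst θ p.1) := by
  classical
  have hm := marginalFst_pos hP1 hθ0 hθP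
  set w : 𝒳 × 𝒳 → ℝ := fun p => θ p / marginalFst θ p.1 with hw
  -- At states of zero `η`-mass the kernel of `η` is undefined; the value `w` keeps the rows
  -- stochastic.
  set v : 𝒳 × 𝒳 → ℝ := fun p =>
    if marginalFst η p.1 = 0 then w p else η p / marginalFst η p.1 with hv
  have hw0 : ∀ p, 0 ≤ w p := fun p => div_nonneg (hθ0 p) (hm _).le
  have hwP : ∀ p : 𝒳 × 𝒳, 0 < P p.1 p.2 → 0 < w p := fun p hp => div_pos (hθP p hp) (hm _)
  have hws : ∀ p : 𝒳 × 𝒳, P p.1 p.2 = 0 → w p = 0 := fun p hp => by simp [hw, hθs p hp]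
  have hw1 : ∀ x, ∑ y, w (x, y) = 1 := fun x => by
    simp only [hw]
    rw [← Finset.sum_div]
    exact div_self (hm x).ne'
  have hv0 : ∀ p, 0 ≤ v p := fun p => by
    simp only [hv]
    split_ifs
    · exact hw0 p
    · exact div_nonneg (hη0 p) (marginalFst_nonneg hη0 _)
  have hvs : ∀ p : 𝒳 × 𝒳, P p.1 p.2 = 0 → v p = 0 := fun p hp => by
    simp [hv, hws p hp, hηs p hp]
  have hv1 : ∀ x, ∑ y, v (x, y) = 1 := fun x => by
    simp only [hv]
    split_ifs with h
    · exact hw1 x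
    · rw [← Finset.sum_div]
      exact div_self h
  have hηv : ∀ p, η p = marginalFst η p.1 * v p := fun p => by
    simp only [hv]
    split_ifs with h
    · rw [h, zero_mul]
      exact le_antisymm ((le_marginalFst hη0 p.1 p.2).trans h.le) (hη0 p)
    · rw [mul_div_cancel₀ _ h]
  -- The midpoint, unlike `v`, is positive wherever `P` is, so its logarithm is a genuine test
  -- function.
  set g : 𝒳 × 𝒳 → ℝ := fun p => Real.log ((w p + v p) / (2 * P p.1 p.2)) with hg
  have hPg : ∀ x y, P x y * Real.exp (g (x, y)) = (w (x, y) + v (x, y)) / 2 := fun x y => by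
    rcases (hP0 x y).eq_or_lt with h | h
    · rw [hws (x, y) h.symm, hvs (x, y) h.symm, ← h]
      simp
    · have := hwP (x, y) h
      have := hv0 (x, y)
      simp only [hg]
      rw [Real.exp_log (by positivity)]
      field_simp
  have hadm : IsSubdensity P g := fun x => by
    simp only [hPg]
    rw [← Finset.sum_div, Finset.sum_add_distrib, hw1, hv1]
    norm_num
  -- From `-log x ≥ 1 - x` at `x = 2 w / (w + v)`, since `v (1 - x) = (v - w) / 2 + (v - w)² / (2 (w
  -- + v))`; the linear part cancels in each row.
  have hterm : ∀ p, marginalFst η p.1 * ((v p - w p) / 2 + (v p - w p) ^ 2 / (2 * (w p + v p))) ≤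
      η p * g p - η p * logKernelDensity P θ p := fun p => by
    rcases (hP0 p.1 p.2).eq_or_lt with h | h
    · simp [hws p h.symm, hvs p h.symm, hηs p h.symm]
    · have hwp := hwP p h
      have hvp := hv0 p
      have hlog : g p - logKernelDensity P θ p = -Real.log (2 * w p / (w p + v p)) := by
        have h1 := hm p.1
        have h2 := hθP p h
        rw [← Real.log_inv, hg, logKernelDensity, ← Real.log_div (by positivity) (by positivity)]
        congr 1
        simp only [hw]
        field_simp
      have h1 := Real.log_le_sub_one_of_pos (show 0 < 2 * w p / (w p + v p) by positivity)
      rw [← mul_sub, hlog, hηv p, mul_assoc]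
      refine mul_le_mul_of_nonneg_left ?_ (marginalFst_nonneg hη0 _)
      refine le_trans (le_of_eq ?_) (mul_le_mul_of_nonneg_left
        (show 1 - 2 * w p / (w p + v p) ≤ _ by linarith) hvp)
      field_simp
      ring
  have hsq : ∀ p, 0 ≤ marginalFst η p.1 * ((v p - w p) ^ 2 / (2 * (w p + v p))) := fun p =>
    mul_nonneg (marginalFst_nonneg hη0 _)
      (div_nonneg (sq_nonneg _) (by linarith [hw0 p, hv0 p]))
  have hsum : ∑ p, marginalFst η p.1 * ((v p - w p) ^ 2 / (2 * (w p + v p))) ≤ 0 := by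
    have h1 := Finset.sum_le_sum fun p (_ : p ∈ Finset.univ) => hterm p
    rw [Finset.sum_sub_distrib] at h1
    rw [Finset.sum_congr rfl fun p _ => mul_add _ _ _, Finset.sum_add_distrib] at h1
    have h2 : ∑ p : 𝒳 × 𝒳, marginalFst η p.1 * ((v p - w p) / 2) = 0 := by
      rw [Fintype.sum_prod_type]
      refine Finset.sum_eq_zero fun x _ => ?_
      change ∑ y, marginalFst η x * ((v (x, y) - w (x, y)) / 2) = 0
      rw [← Finset.mul_sum, ← Finset.sum_div, Finset.sum_sub_distrib, hv1, hw1]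
      simp
    linarith [hmax g hadm]
  have h0 := (Finset.sum_eq_zero_iff_of_nonneg fun p _ => hsq p).1
    (le_antisymm hsum (Finset.sum_nonneg fun p _ => hsq p)) p (Finset.mem_univ p)
  rw [hηv p]
  rcases mul_eq_zero.1 h0 with h | h
  · rw [h, zero_mul, zero_mul]
  · rcases div_eq_zero_iff.1 h with h | h
    · rw [sub_eq_zero.1 (pow_eq_zero_iff two_ne_zero |>.1 h)]
    · have h1 := hw0 p
      have h2 := hv0 p
      have h3 : v p = w p := by linarith
      rw [h3]

include hP0 hP1 in
/-- The functional attached to `lam` and the kernel of `θ` exposes the pair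
`(θ ∇φ(lam), θ)`. -/
lemma exists_tilt_lt_of_ne (hP : P.IsIrreducible) (hq : ∀ x y, HasExpMoments (q x y))
    (θ : stdSimplex ℝ (𝒳 × 𝒳)) (hθP : ∀ p : 𝒳 × 𝒳, 0 < P p.1 p.2 → 0 < θ.1 p)
    (hθs : ∀ p : 𝒳 × 𝒳, P p.1 p.2 = 0 → θ.1 p = 0) (hθm : marginalFst θ.1 = marginalSnd θ.1)
    (lam : 𝒳 × 𝒳 → Fin d → ℝ) (z : (𝒳 × 𝒳 → Fin d → ℝ) × stdSimplex ℝ (𝒳 × 𝒳))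
    (hz : z ≠ (fun p => θ.1 p • tiltedMean (q p.1 p.2) (lam p), θ)) :
    ∃ f ∈ tilts P q, tilt q lam (logKernelDensity P θ.1) 0 z < f z := by
  classical
  by_contra! hcon
  have hm := marginal_eq_of_tilt_le hP1 hcon
  have hs : ∀ p : 𝒳 × 𝒳, P p.1 p.2 = 0 → z.2.1 p = 0 := fun p =>
    theta_eq_zero_of_tilt_le hP1 hcon
  have hadm : IsSubdensity P (logKernelDensity P θ.1) := fun x =>
    (sum_mul_exp_logKernelDensity hP0 hP1 θ.2.1 hθP hθs x).le
  -- Varying `g` alone identifies the kernel, and uniqueness of the balanced distribution then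
  -- identifies `θ`.
  have hker := kernel_eq_of_sum_le hP0 hP1 θ.2.1 hθP hθs z.2.2.1 hs fun g hg => by
    have := hcon _ ⟨lam, g, 0, hg, rfl⟩
    rw [tilt_eq, tilt_eq] at this
    linarith
  have hθ : z.2.1 = θ.1 := eq_of_same_kernel hP θ.2.1 hθP hθm θ.2.2 hm z.2.2.2 hker
  -- Varying `lam` at one pair in one coordinate: the first-order condition at the maximum
  -- identifies `k`.
  have hk : ∀ p i, z.1 p i = θ.1 p * tiltedMean (q p.1 p.2) (lam p) i := fun p i => by
    have hd : HasDerivAt (fun t : ℝ => (lam p + t • Pi.single i 1) ⬝ᵥ z.1 p -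
        θ.1 p * cumulant (q p.1 p.2) (lam p + t • Pi.single i 1))
        (z.1 p i - θ.1 p * tiltedMean (q p.1 p.2) (lam p) i) 0 := by
      refine HasDerivAt.sub ?_ (((hq p.1 p.2).hasDerivAt_cumulant (lam p) i).const_mul _)
      have : ∀ t : ℝ, (lam p + t • Pi.single i 1) ⬝ᵥ z.1 p = lam p ⬝ᵥ z.1 p + t * z.1 p i :=
        fun t => by simp [add_dotProduct, smul_dotProduct]
      simp only [this]
      simpa using ((hasDerivAt_id (0 : ℝ)).mul_const (z.1 p i)).const_add (lam p ⬝ᵥ z.1 p)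
    have hmax : IsLocalMax (fun t : ℝ => (lam p + t • Pi.single i 1) ⬝ᵥ z.1 p -
        θ.1 p * cumulant (q p.1 p.2) (lam p + t • Pi.single i 1)) 0 := by
      refine Eventually.of_forall fun t => ?_
      have := hcon _ ⟨Function.update lam p (lam p + t • Pi.single i 1), logKernelDensity P θ.1, 0,
        hadm, rfl⟩
      rw [tilt_eq, tilt_eq, add_le_add_iff_right, add_le_add_iff_right,
        ← Finset.add_sum_erase _ _ (Finset.mem_univ p),
        ← Finset.add_sum_erase _ (fun p => lam p ⬝ᵥ z.1 p -
          z.2.1 p * cumulant (q p.1 p.2) (lam p)) (Finset.mem_univ p),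
        Finset.sum_congr (g := fun p => lam p ⬝ᵥ z.1 p -
          z.2.1 p * cumulant (q p.1 p.2) (lam p)) rfl fun p' hp' => by
            rw [Function.update_of_ne (Finset.ne_of_mem_erase hp')],
        add_le_add_iff_right, Function.update_self, hθ] at this
      simpa using this
    have := hmax.hasDerivAt_eq_zero hd
    linarith
  exact hz (Prod.ext (funext fun p => funext fun i => hk p i) (Subtype.ext hθ))

end Exposed

/-! ### Density of exposed points, with control of the rate. -/

section Approximation

variable {𝒳 : Type*} [Fintype 𝒳] {d : ℕ}
  {P : Matrix 𝒳 𝒳 ℝ} {q : 𝒳 → 𝒳 → Measure (Fin d → ℝ)}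

lemma tilt_affine (lam : 𝒳 × 𝒳 → Fin d → ℝ) (g : 𝒳 × 𝒳 → ℝ) (u : 𝒳 → ℝ) (t : ℝ)
    (z₁ z₂ z₃ : (𝒳 × 𝒳 → Fin d → ℝ) × stdSimplex ℝ (𝒳 × 𝒳))
    (hk : z₃.1 = (1 - t) • z₁.1 + t • z₂.1) (hθ : z₃.2.1 = (1 - t) • z₁.2.1 + t • z₂.2.1) :
    tilt q lam g u z₃ = (1 - t) * tilt q lam g u z₁ + t * tilt q lam g u z₂ := by
  simp only [tilt, hk, hθ]
  rw [Finset.mul_sum, Finset.mul_sum, ← Finset.sum_add_distrib]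
  refine Finset.sum_congr rfl fun p _ => ?_
  simp only [Pi.add_apply, Pi.smul_apply, smul_eq_mul, dotProduct_add, dotProduct_smul]
  ring

variable [∀ x y, IsProbabilityMeasure (q x y)]
  (hP0 : ∀ x y, 0 ≤ P x y) (hP1 : ∀ x, ∑ y, P x y = 1)

-- Provides a finite-rate pair to mix with: the `lam` block is nonpositive by Jensen, and a
-- substochastic density satisfies `g ≤ -log P` on the support of `P`.
include hP0 in
lemma tilt_mean_le (hq : ∀ x y, HasExpMoments (q x y)) (θ : stdSimplex ℝ (𝒳 × 𝒳))
    (hθs : ∀ p : 𝒳 × 𝒳, P p.1 p.2 = 0 → θ.1 p = 0) (hθm : marginalFst θ.1 = marginalSnd θ.1) :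
    ∃ B : ℝ, ∀ f ∈ tilts P q, f (fun p => θ.1 p • tiltedMean (q p.1 p.2) 0, θ) ≤ B := by
  refine ⟨∑ p : 𝒳 × 𝒳, θ.1 p * -Real.log (P p.1 p.2), ?_⟩
  rintro f ⟨lam, g, u, hg, rfl⟩
  rw [tilt_eq, hθm]
  simp only [sub_self, mul_zero, Finset.sum_const_zero, add_zero]
  have h1 : ∑ p : 𝒳 × 𝒳, (lam p ⬝ᵥ (θ.1 p • tiltedMean (q p.1 p.2) 0) -
      θ.1 p * cumulant (q p.1 p.2) (lam p)) ≤ 0 := by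
    refine Finset.sum_nonpos fun p _ => ?_
    rw [dotProduct_smul, smul_eq_mul, ← mul_sub]
    exact mul_nonpos_of_nonneg_of_nonpos (θ.2.1 p)
      (sub_nonpos.2 ((hq p.1 p.2).dotProduct_mean_le (lam p)))
  have h2 : ∑ p, θ.1 p * g p ≤ ∑ p : 𝒳 × 𝒳, θ.1 p * -Real.log (P p.1 p.2) := by
    refine Finset.sum_le_sum fun p _ => ?_
    rcases (hP0 p.1 p.2).eq_or_lt with h | h
    · simp [hθs p h.symm]
    · refine mul_le_mul_of_nonneg_left ?_ (θ.2.1 p)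
      have h3 : P p.1 p.2 * Real.exp (g p) ≤ 1 :=
        (Finset.single_le_sum (f := fun y => P p.1 y * Real.exp (g (p.1, y)))
          (fun y _ => mul_nonneg (hP0 _ _) (Real.exp_pos _).le) (Finset.mem_univ p.2)).trans
          (hg p.1)
      rw [← Real.log_inv, Real.le_log_iff_exp_le (inv_pos.2 h), ← one_div, le_div_iff₀' h]
      exact h3
  linarith

include hP0 hP1 in
/-- Every pair of finite rate is approximated by exposed pairs. -/
lemma exists_exposed_near [Nonempty 𝒳] (hP : P.IsIrreducible)
    (hq : ∀ x y, HasExpMoments (q x y))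
    (z : (𝒳 × 𝒳 → Fin d → ℝ) × stdSimplex ℝ (𝒳 × 𝒳)) (r : ℝ)
    (hr : ∀ f ∈ tilts P q, f z ≤ r) (U : Set ((𝒳 × 𝒳 → Fin d → ℝ) × stdSimplex ℝ (𝒳 × 𝒳)))
    (hU : U ∈ 𝓝 z) (ε : ℝ) (hε : 0 < ε) :
    ∃ (lam : 𝒳 × 𝒳 → Fin d → ℝ) (θ : stdSimplex ℝ (𝒳 × 𝒳)),
      (∀ p : 𝒳 × 𝒳, 0 < P p.1 p.2 → 0 < θ.1 p) ∧
      (∀ p : 𝒳 × 𝒳, P p.1 p.2 = 0 → θ.1 p = 0) ∧ marginalFst θ.1 = marginalSnd θ.1 ∧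
      (fun p => θ.1 p • tiltedMean (q p.1 p.2) (lam p), θ) ∈ U ∧
      tilt q lam (logKernelDensity P θ.1) 0
        (fun p => θ.1 p • tiltedMean (q p.1 p.2) (lam p), θ) ≤ r + ε := by
  obtain ⟨ρ, hρ, hball⟩ := Metric.mem_nhds_iff.1 hU
  obtain ⟨θ₀, hθ₀P, hθ₀s, hθ₀m⟩ := exists_positive_circulation hP hP1
  obtain ⟨B, hB⟩ := tilt_mean_le hP0 hq θ₀ hθ₀s hθ₀m
  set k₀ : 𝒳 × 𝒳 → Fin d → ℝ := fun p => θ₀.1 p • tiltedMean (q p.1 p.2) 0 with hk₀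
  have hm := marginal_eq_of_tilt_le hP1 hr
  have hs : ∀ p : 𝒳 × 𝒳, P p.1 p.2 = 0 → z.2.1 p = 0 := fun p =>
    theta_eq_zero_of_tilt_le hP1 hr
  -- A small positive weight on the positive circulation charges the whole support while perturbing
  -- the position and the bound `r` arbitrarily little.
  obtain ⟨t, ht0, ht1, htk, htθ, htB⟩ : ∃ t : ℝ, 0 < t ∧ t ≤ 1 ∧
      dist ((1 - t) • z.1 + t • k₀) z.1 < ρ / 2 ∧
      dist ((1 - t) • z.2.1 + t • θ₀.1) z.2.1 < ρ ∧ (1 - t) * r + t * B < r + ε := by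
    have c1 : Continuous fun t : ℝ => dist ((1 - t) • z.1 + t • k₀) z.1 := by fun_prop
    have c2 : Continuous fun t : ℝ => dist ((1 - t) • z.2.1 + t • θ₀.1) z.2.1 := by fun_prop
    have c3 : Continuous fun t : ℝ => (1 - t) * r + t * B := by fun_prop
    have e1 := (c1.tendsto 0).eventually_lt_const (u := ρ / 2) (by simpa using hρ)
    have e2 := (c2.tendsto 0).eventually_lt_const (u := ρ) (by simpa using hρ)
    have e3 := (c3.tendsto 0).eventually_lt_const (u := r + ε) (by simpa using hε)
    have e4 : ∀ᶠ t : ℝ in 𝓝 0, t < 1 := eventually_lt_nhds one_pos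
    have e5 : ∀ᶠ t : ℝ in 𝓝[>] 0, 0 < t := eventually_mem_nhdsWithin
    obtain ⟨t, h5, ⟨h1, h2⟩, h3, h4⟩ := (e5.and (((e1.and e2).and (e3.and e4)).filter_mono
      nhdsWithin_le_nhds)).exists
    exact ⟨t, h5, h4.le, h1, h2, h3⟩
  set θ : stdSimplex ℝ (𝒳 × 𝒳) := ⟨(1 - t) • z.2.1 + t • θ₀.1,
    convex_stdSimplex ℝ _ z.2.2 θ₀.2 (by linarith) ht0.le (by ring)⟩ with hθ
  set k : 𝒳 × 𝒳 → Fin d → ℝ := (1 - t) • z.1 + t • k₀ with hk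
  have hθval : ∀ p, θ.1 p = (1 - t) * z.2.1 p + t * θ₀.1 p := fun p => rfl
  have hθP : ∀ p : 𝒳 × 𝒳, 0 < P p.1 p.2 → 0 < θ.1 p := fun p hp => by
    rw [hθval]
    have h1 := mul_nonneg (sub_nonneg.2 ht1) (z.2.2.1 p)
    have h2 := mul_pos ht0 (hθ₀P p hp)
    linarith
  have hθs : ∀ p : 𝒳 × 𝒳, P p.1 p.2 = 0 → θ.1 p = 0 := fun p hp => by
    rw [hθval, hs p hp, hθ₀s p hp]
    simp
  have hθm : marginalFst θ.1 = marginalSnd θ.1 := by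
    funext v
    change marginalFst ((1 - t) • z.2.1 + t • θ₀.1) v = marginalSnd ((1 - t) • z.2.1 + t • θ₀.1) v
    rw [marginalFst_add, marginalSnd_add, marginalFst_smul, marginalFst_smul, marginalSnd_smul,
      marginalSnd_smul, hm, hθ₀m]
  have hbound : ∀ f ∈ tilts P q, f (k, θ) ≤ (1 - t) * r + t * B := by
    rintro f ⟨lam, g, u, hg, rfl⟩
    rw [tilt_affine lam g u t z (k₀, θ₀) (k, θ) rfl rfl]
    have h1 := hr _ ⟨lam, g, u, hg, rfl⟩
    have h2 := hB _ ⟨lam, g, u, hg, rfl⟩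
    have h3 := mul_le_mul_of_nonneg_left h1 (sub_nonneg.2 ht1)
    have h4 := mul_le_mul_of_nonneg_left h2 ht0.le
    linarith
  -- Besides closeness, the linear inequality is what keeps the tilting functional at the exposed
  -- point below its value at `(k, θ)`, however large `l` is.
  have hchoose : ∀ p : 𝒳 × 𝒳, ∃ l : Fin d → ℝ,
      (∀ i, |θ.1 p * tiltedMean (q p.1 p.2) l i - k p i| ≤ ρ / 4) ∧
        l ⬝ᵥ (θ.1 p • tiltedMean (q p.1 p.2) l) ≤ l ⬝ᵥ k p := fun p => by
    rcases (θ.2.1 p).eq_or_lt with h | h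
    · have hkp : k p = 0 := eq_zero_of_tilt_le (z := (k, θ)) hP1 hbound h.symm
      refine ⟨0, fun i => ?_, by simp⟩
      rw [hkp, ← h]
      simp
      positivity
    · have hne : θ.1 p ≠ 0 := h.ne'
      obtain ⟨l, hl, hl'⟩ := (hq p.1 p.2).exists_tiltedMean_near ((θ.1 p)⁻¹ • k p)
        (((1 - t) * r + t * B) / θ.1 p) (fun l => by
          rw [le_div_iff₀' h, ← dotProduct_sub_mul_eq hne]
          exact dotProduct_sub_le_of_tilt_le (z := (k, θ)) hP1 hbound p l)
        (η := ρ / 4) (by positivity)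
      refine ⟨l, fun i => ?_, ?_⟩
      · have h1 := hl i
        have h2 : θ.1 p * tiltedMean (q p.1 p.2) l i - k p i =
            θ.1 p * (tiltedMean (q p.1 p.2) l i - ((θ.1 p)⁻¹ • k p) i) := by
          rw [Pi.smul_apply, smul_eq_mul, mul_sub, mul_inv_cancel_left₀ hne]
        rw [h2, abs_mul, abs_of_pos h]
        calc θ.1 p * _ ≤ 1 * (ρ / 4) := by
              gcongr
              exact theta_le_one θ p
          _ = ρ / 4 := one_mul _
      · rw [dotProduct_smul, smul_eq_mul]
        calc θ.1 p * (l ⬝ᵥ tiltedMean (q p.1 p.2) l) ≤ θ.1 p * (l ⬝ᵥ ((θ.1 p)⁻¹ • k p)) := by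
              gcongr
          _ = l ⬝ᵥ k p := by rw [dotProduct_smul, smul_eq_mul, mul_inv_cancel_left₀ hne]
  choose lam hlam hlam' using hchoose
  refine ⟨lam, θ, hθP, hθs, hθm, hball ?_, ?_⟩
  · have h1 : dist (fun p => θ.1 p • tiltedMean (q p.1 p.2) (lam p)) k ≤ ρ / 4 := by
      refine (dist_pi_le_iff (by positivity)).2 fun p => (dist_pi_le_iff (by positivity)).2
        fun i => ?_
      rw [Real.dist_eq]
      exact hlam p i
    rw [Metric.mem_ball, Prod.dist_eq, max_lt_iff]
    refine ⟨?_, htθ⟩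
    linarith [dist_triangle (fun p => θ.1 p • tiltedMean (q p.1 p.2) (lam p)) k z.1]
  · have hadm : IsSubdensity P (logKernelDensity P θ.1) := fun x =>
      (sum_mul_exp_logKernelDensity hP0 hP1 θ.2.1 hθP hθs x).le
    have h1 := hbound _ ⟨lam, logKernelDensity P θ.1, 0, hadm, rfl⟩
    have h2 : tilt q lam (logKernelDensity P θ.1) 0
        (fun p => θ.1 p • tiltedMean (q p.1 p.2) (lam p), θ) ≤
        tilt q lam (logKernelDensity P θ.1) 0 (k, θ) := by
      rw [tilt, tilt]
      exact Finset.sum_le_sum fun p _ => add_le_add (hlam' p) le_rfl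
    linarith

end Approximation

/-! ### Assembly, and irrelevance of the laws on forbidden transitions. -/

section Final

variable {Ω 𝒳 : Type*} [MeasurableSpace Ω] {μ : Measure Ω} [IsProbabilityMeasure μ]
  [Fintype 𝒳] [DecidableEq 𝒳] [MeasurableSpace 𝒳] [MeasurableSingletonClass 𝒳]
  {d : ℕ} {P : Matrix 𝒳 𝒳 ℝ} {X : ℕ → Ω → 𝒳} {A : ℕ → Ω → Fin d → ℝ}
  {q : 𝒳 → 𝒳 → Measure (Fin d → ℝ)}

/-- The large-deviation principle when all `q x y` have finite exponential moments. -/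
theorem satisfiesLDP_of_hasExpMoments (hX : ∀ m, Measurable (X m)) (hM : IsMarkovChain μ P X)
    (hP : P.IsIrreducible) (hA : ∀ m, 1 ≤ m → Measurable (A m))
    [∀ x y, IsProbabilityMeasure (q x y)] (hIndep : CondIndepOnTransitions μ X A q)
    (hq : ∀ x y, HasExpMoments (q x y)) :
    SatisfiesLDP μ (fun n ω => (empiricalK X A n ω, empiricalTheta X n ω)) (rate P q) := by
  obtain ⟨hP0, hP1⟩ := Matrix.mem_rowStochastic_iff_sum.1 hM.stochastic
  have : Nonempty Ω := nonempty_of_isProbabilityMeasure μ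
  have : Nonempty 𝒳 := this.map (X 0)
  refine satisfiesLDP_of_exposed _ (measurable_empirical hX hA) normFst continuous_normFst
    isCompact_normFst_le (tilts P q) ?_
    (fun f hf => exists_lintegral_exp_tilt_le hX hA hM hIndep hP0 hq hf)
    (exists_lintegral_exp_normFst_le hX hA hM hIndep hq) ?_ (rate P q)
    (fun f hf z => tilt_le_rate hP0 hP1 hq hf z) (exists_lt_tilt_of_lt_rate hP0 hP1 hq) ?_
    (exists_normFst_sub_le_tilt hP1 hq) ?_
  · rintro f ⟨lam, g, u, -, rfl⟩
    exact continuous_tilt lam g u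
  · rintro f ⟨lam, g, u, -, rfl⟩
    exact tilt_le_add_mul_normFst lam g u
  · refine ⟨0, 0, 0, isSubdensity_zero hP1, ?_⟩
    funext z
    simp [tilt]
  · intro z r hr U hU ε hε
    obtain ⟨lam, θ, hθP, hθs, hθm, hmem, hle⟩ := exists_exposed_near hP0 hP1 hP hq z r
      (fun f hf => EReal.coe_le_coe_iff.1 ((tilt_le_rate hP0 hP1 hq hf z).trans hr)) U hU ε hε
    have hone := sum_mul_exp_logKernelDensity hP0 hP1 θ.2.1 hθP hθs
    exact ⟨_, ⟨lam, logKernelDensity P θ.1, 0, fun x => (hone x).le, rfl⟩, _, hmem, hle,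
      one_le_lintegral_exp_tilt hX hA hM hIndep hP0 hq lam _ fun x => (hone x).ge,
      exists_tilt_lt_of_ne hP0 hP1 hP hq θ hθP hθs hθm lam⟩

lemma hasExpMoments_dirac_zero : HasExpMoments (Measure.dirac (0 : Fin d → ℝ)) := fun s =>
  integrable_dirac (by simp)

lemma logMGFConj_nonneg {ν : Measure (Fin d → ℝ)} [IsProbabilityMeasure ν] (a : Fin d → ℝ) :
    0 ≤ logMGFConj ν a := by
  refine le_trans (le_of_eq ?_) (le_iSup _ (0 : Fin d → ℝ))
  simp [logMGF]

lemma relEnt_nonneg {a b : ℝ} (hb : 0 ≤ b) : 0 ≤ relEnt a b := by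
  simpa using le_relEnt hb (a := a) 0

-- A charged forbidden transition has infinite relative entropy; all other summands are nonnegative,
-- so no `⊥` can absorb it in `EReal`.
omit [DecidableEq 𝒳] [MeasurableSpace 𝒳] [MeasurableSingletonClass 𝒳] in
lemma rate_eq_top_of_support (hP0 : ∀ x y, 0 ≤ P x y) [∀ x y, IsProbabilityMeasure (q x y)]
    (z : (𝒳 × 𝒳 → Fin d → ℝ) × stdSimplex ℝ (𝒳 × 𝒳)) {x y : 𝒳} (hxy : P x y = 0)
    (hz : z.2.1 (x, y) ≠ 0) : rate P q z = ⊤ := by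
  have hθ : ∀ p, 0 ≤ z.2.1 p := z.2.2.1
  have hrel : ∀ x y, 0 ≤ relEnt (z.2.1 (x, y)) (marginalFst z.2.1 x * P x y) := fun x y =>
    relEnt_nonneg (mul_nonneg (marginalFst_nonneg hθ x) (hP0 x y))
  rw [rate]
  split_ifs with h
  swap
  · rfl
  have h1 : ∑ x, ∑ y, relEnt (z.2.1 (x, y)) (marginalFst z.2.1 x * P x y) = ⊤ := by
    rw [← top_le_iff]
    calc (⊤ : EReal) = relEnt (z.2.1 (x, y)) (marginalFst z.2.1 x * P x y) := by
          simp [relEnt, hxy, hz]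
      _ ≤ ∑ y, relEnt (z.2.1 (x, y)) (marginalFst z.2.1 x * P x y) :=
          Finset.single_le_sum (f := fun y => relEnt (z.2.1 (x, y)) (marginalFst z.2.1 x * P x y))
            (fun y _ => hrel x y) (Finset.mem_univ y)
      _ ≤ _ := Finset.single_le_sum
            (f := fun x => ∑ y, relEnt (z.2.1 (x, y)) (marginalFst z.2.1 x * P x y))
            (fun x _ => Finset.sum_nonneg fun y _ => hrel x y) (Finset.mem_univ x)
  rw [h1]
  refine EReal.add_top_of_ne_bot (ne_bot_of_le_ne_bot EReal.zero_ne_bot ?_)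
  refine Finset.sum_nonneg fun x _ => Finset.sum_nonneg fun y _ => ?_
  split_ifs
  · exact le_rfl
  · exact mul_nonneg (by exact_mod_cast hθ _) (logMGFConj_nonneg _)

omit [DecidableEq 𝒳] [MeasurableSpace 𝒳] [MeasurableSingletonClass 𝒳] in
lemma rate_congr_of_support (hP0 : ∀ x y, 0 ≤ P x y) {q' : 𝒳 → 𝒳 → Measure (Fin d → ℝ)}
    [∀ x y, IsProbabilityMeasure (q x y)] [∀ x y, IsProbabilityMeasure (q' x y)]
    (h : ∀ x y, 0 < P x y → q' x y = q x y) : rate P q' = rate P q := by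
  funext z
  by_cases hz : ∀ x y, P x y = 0 → z.2.1 (x, y) = 0
  · simp only [rate]
    congr 2
    refine Finset.sum_congr rfl fun x _ => Finset.sum_congr rfl fun y _ => ?_
    split_ifs with h0
    · rfl
    · rw [h x y (lt_of_le_of_ne (hP0 x y) fun h1 => h0 (hz x y h1.symm))]
  · push Not at hz
    obtain ⟨x, y, hxy, h0⟩ := hz
    rw [rate_eq_top_of_support hP0 z hxy h0, rate_eq_top_of_support hP0 z hxy h0]

lemma CondIndepOnTransitions.congr_of_support (hX : ∀ m, Measurable (X m))
    (hM : IsMarkovChain μ P X) {q' : 𝒳 → 𝒳 → Measure (Fin d → ℝ)}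
    (h : ∀ x y, 0 < P x y → q' x y = q x y) (hIndep : CondIndepOnTransitions μ X A q) :
    CondIndepOnTransitions μ X A q' := by
  intro n x hx
  rw [hIndep n x hx]
  congr 1
  funext m
  refine (h _ _ ?_).symm
  by_contra hcon
  -- A path through a forbidden transition is already null when truncated just after that
  -- transition.
  refine hx (measure_mono_null (t := pathEvent X (m + 1) x) (fun ω hω i hi => hω i (by lia)) ?_)
  rw [measure_pathEvent_succ hX hM, ENNReal.ofReal_of_nonpos (not_lt.1 hcon), mul_zero]

end Final

end PairLDP

theorem theorem1 {Ω 𝒳 : Type*} [MeasurableSpace Ω] (μ : Measure Ω) [IsProbabilityMeasure μ]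
    [Fintype 𝒳] [DecidableEq 𝒳] [MeasurableSpace 𝒳] [MeasurableSingletonClass 𝒳]
    (d : ℕ) (P : Matrix 𝒳 𝒳 ℝ)
    (X : ℕ → Ω → 𝒳) (hX : ∀ m, Measurable (X m))
    (hMarkov : PairLDP.IsMarkovChain μ P X) (hIrr : P.IsIrreducible)
    (A : ℕ → Ω → Fin d → ℝ) (hA : ∀ m, 1 ≤ m → Measurable (A m))
    (q : 𝒳 → 𝒳 → Measure (Fin d → ℝ)) (hq : ∀ x y, IsProbabilityMeasure (q x y))
    (hIndep : PairLDP.CondIndepOnTransitions μ X A q)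
    (hGrowth : ∀ x y, 0 < P x y →
      liminf (fun r : ℝ => PairLDP.logMGFNormConj (q x y) r / (r : EReal)) atTop = ⊤) :
    PairLDP.SatisfiesLDP μ
      (fun n ω => (PairLDP.empiricalK X A n ω, PairLDP.empiricalTheta X n ω))
      (PairLDP.rate P q) := by
  classical
  -- Growth is only assumed on the support of `P`. Dirac masses elsewhere provide exponential
  -- moments for all pairs without changing the rate functional or the conditional laws.
  set q' : 𝒳 → 𝒳 → Measure (Fin d → ℝ) := fun x y =>
    if 0 < P x y then q x y else Measure.dirac 0 with hq'
  have hpos : ∀ x y, 0 < P x y → q' x y = q x y := fun x y h => if_pos h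
  have : ∀ x y, IsProbabilityMeasure (q' x y) := fun x y => by
    simp only [hq']
    split_ifs <;> infer_instance
  have hexp : ∀ x y, PairLDP.HasExpMoments (q' x y) := fun x y => by
    simp only [hq']
    split_ifs with h
    · exact PairLDP.hasExpMoments_of_growth (hGrowth x y h)
    · exact PairLDP.hasExpMoments_dirac_zero
  rw [← PairLDP.rate_congr_of_support hIrr.nonneg hpos]
  exact PairLDP.satisfiesLDP_of_hasExpMoments hX hMarkov hIrr hA
    (hIndep.congr_of_support hX hMarkov hpos) hexp
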